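/- **Setting.** Let $\mathsf F_0,\mathsf F_1$ be classes of unimodal Kripke frames, with signatures $\{0\}$ and $\{1\}$, closed under isomorphic copies and (non-empty) disjoint unions. Let $\mathsf F_0\otimes\mathsf F_1$ be the class of bimodal frames $\langle W,R_0,R_1\rangle$ with $\langle W,R_0\rangle\in\mathsf F_0$ and $\langle W,R_1\rangle\in\mathsf F_1$. Let $F_0\in\mathsf F_0$ have pairwise different worlds $w_0,w_1,w_2$ with $w_0Rw_1$ and $w_0Rw_2$, and let $F_1\in\mathsf F_1$ have different worlds $u_0,u_1$ with $u_0Ru_1$. **Parity games.** A parity game $\mathcal P=\langle V_\exists,V_\forall,v_0,E,\Omega\rangle$ has disjoint sets $V_\exists,V_\forall$ of vertices (put $V=V_\exists\cup V_\forall$), an initial vertex $v_0\in V$, a set of edges $E\subseteq V^2$ and a bounded parity function $\Omega:V\to\mathbb N$. The players $\exists$ and $\forall$ move a token along edges, starting at $v_0$; the owner of the current vertex moves. A player with no available move loses, and $\exists$ wins an infinite play iff the greatest parity appearing infinitely often is even. A strategy for $\exists$ is a function $V_\exists\to V$ giving an admissible move wherever there is one; $\exists$ wins $\mathcal P$ iff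 some strategy for $\exists$ makes $\exists$ win every play following it. The unfolding of $\mathcal P$ is the game on the finite paths of $\mathcal P$ starting at $v_0$, in which a move extends a path by one edge, and owner and parity of a path are those of its last vertex; its initial vertex is the path of length $0$. **The model $\mathcal P^{\mathrm K}$.** Let every vertex $v$ of $\mathcal P$ have finitely many successors, listed without repetition in an arbitrary fixed order. $\mathcal P^{\mathrm K}=\langle W,R_0,R_1,V\rangle$ is glued from copies of $F_0$ (making up $R_0$) and of $F_1$ (making up $R_1$). There is a world $\underline v$ for each vertex $v$. The following describes the choice from a list $a_1,\dots,a_m$ with $m\ge 1$ at a world $x$; it is made at each $\underline v$ such that $v$ has a successor, from the list of all successors of $v$. * A fresh copy of $F_0$ is attached at $x$, with $x$ as its point $w_0$. Its point $w_1$ is the point $u_0$ of a fresh copy of $F_1$ whose point $u_1$ is $\underline{a_1}$. * If $m=2$, the point $w_2$ is the point $u_0$ of a fresh copy of $F_1$ whose point $u_1$ is $\underline{a_2}$. * If $m\ge3$, the point $w_2$ is the point $u_0$ of a fresh copy of $F_1$ whose point $u_1$ is a new world, at which the choice from $a_2,\dots,a_m$ is made. * If $m=1$, the point $w_2$ is not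 used. Every other point of these copies is a new world. Moreover, every world that is in no copy of $F_0$ yet becomes the point $w_0$ of a fresh copy of $F_0$, every world that is in no copy of $F_1$ yet becomes the point $u_0$ of a fresh copy of $F_1$, and so on recursively, all other points of these copies being new worlds. The valuation is as follows. * $\mathrm{pre}_0$ holds at the worlds $x$ where a choice is made. * $\mathrm{nxt}_0$ and $\mathrm{pre}_1$ hold at the used points $w_1,w_2$ of the copies of $F_0$ attached for choices. * $\mathrm{nxt}_1$ holds at the end points $u_1$ of the copies of $F_1$ attached to these. * $\mathrm{bd}$ holds at all worlds just named and at all $\underline v$. * $\mathrm{pos}$ holds exactly at the worlds $\underline v$. * $P_\exists$, $P_\forall$ and $P_j$ ($j\in\mathbb N$) hold exactly at the $\underline v$ with $v\in V_\exists$, $v\in V_\forall$ and $\Omega(v)=j$, respectively. **The formulas $W_n$.** With $Y$ a fresh variable, put $$\blacklozenge\varphi:=\nu Y.\,\mathrm{pre}_0\land\mathrm{bd}\land\Diamond_0(\mathrm{nxt}_0\land\mathrm{pre}_1\land\mathrm{bd}\land\Diamond_1(\mathrm{nxt}_1\land\mathrm{bd}\land((Y\land\neg\mathrm{pos})\lor(\varphi\land\mathrm{pos})))),$$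 $$\blacksquare\varphi:=\nu Y.\,\mathrm{pre}_0\land\mathrm{bd}\to\Box_0(\mathrm{nxt}_0\land\mathrm{pre}_1\land\mathrm{bd}\to\Box_1(\mathrm{nxt}_1\land\mathrm{bd}\to((Y\land\neg\mathrm{pos})\lor(\varphi\land\mathrm{pos})))),$$ $$W_n:=\eta X_n\dots\nu X_2\,\mu X_1\,\nu X_0.\bigvee_{0\le j\le n}[(P_j\land P_\exists\land\blacklozenge X_j)\lor(P_j\land P_\forall\land\blacksquare X_j)],$$ where $X_j$ is bound by $\nu$ if $j$ is even and by $\mu$ if $j$ is odd. **Proposition.** Let $\mathcal P$ be a parity game and let $n\in\mathbb N$ with $\Omega(v)\le n$ for all $v\in V$. 1. If every vertex of $\mathcal P$ has finitely many successors, then $$\mathcal P^{\mathrm K},\underline{v}_0\models W_n\quad\text{iff}\quad\exists\text{ wins }\mathcal P;$$ and if moreover every vertex of $\mathcal P$ has at most one predecessor (in particular if $\mathcal P$ is a tree), then the frame of $\mathcal P^{\mathrm K}$ is in $\mathsf F_0\otimes\mathsf F_1$. 2. Let $\mathcal Q$ be the unfolding of $\mathcal P$, and suppose that every vertex of $\mathcal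 Q$ has finitely many successors. Then the frame of $\mathcal Q^{\mathrm K}$ is in $\mathsf F_0\otimes\mathsf F_1$, and $W_n$ holds in $\mathcal Q^{\mathrm K}$ at the world of the initial vertex of $\mathcal Q$ iff $\exists$ wins $\mathcal P$. -/

import Mathlib

universe u

/-! ## Kripke frames and models, the modal mu-calculus -/

/-- A Kripke frame with signature `Λ`. -/
structure KFrame (Λ : Type) where
  World : Type u
  Rel : Λ → World → World → Prop

/-- A unimodal Kripke frame (the single modality is indexed by `()`). -/
abbrev UFrame := KFrame.{u} Unit

/-- A Kripke model with signature `Λ` and propositional symbols `A`. -/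
structure KModel (Λ A : Type) extends KFrame.{u} Λ where
  val : A → Set World

/-- The formulas of the mu-calculus, with propositional symbols `A`, variables `Vr`, signature `Λ`. -/
inductive MuFormula (A Vr Λ : Type) : Type
  | prop (p : A)
  | nprop (p : A)
  | var (X : Vr)
  | and (φ ψ : MuFormula A Vr Λ)
  | or (φ ψ : MuFormula A Vr Λ)
  | box (i : Λ) (φ : MuFormula A Vr Λ)
  | dia (i : Λ) (φ : MuFormula A Vr Λ)
  | mu (X : Vr) (φ : MuFormula A Vr Λ)
  | nu (X : Vr) (φ : MuFormula A Vr Λ)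

/-- The valuation of a formula as a monotone function of the values of the variables. -/
def KModel.sem {Λ A Vr : Type} [DecidableEq Vr] (M : KModel.{u} Λ A) :
    MuFormula A Vr Λ → ((Vr → Set M.World) →o Set M.World)
  | .prop p => ⟨fun _ => M.val p, fun _ _ _ => le_rfl⟩
  | .nprop p => ⟨fun _ => (M.val p)ᶜ, fun _ _ _ => le_rfl⟩
  | .var X => ⟨fun ρ => ρ X, fun _ _ h => h X⟩
  | .and φ ψ => ⟨fun ρ => M.sem φ ρ ∩ M.sem ψ ρ,
      fun _ _ h => Set.inter_subset_inter ((M.sem φ).monotone h) ((M.sem ψ).monotone h)⟩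
  | .or φ ψ => ⟨fun ρ => M.sem φ ρ ∪ M.sem ψ ρ,
      fun _ _ h => Set.union_subset_union ((M.sem φ).monotone h) ((M.sem ψ).monotone h)⟩
  | .box i φ => ⟨fun ρ => {w | ∀ v, M.Rel i w v → v ∈ M.sem φ ρ},
      fun _ _ h _ hw v hv => (M.sem φ).monotone h (hw v hv)⟩
  | .dia i φ => ⟨fun ρ => {w | ∃ v, M.Rel i w v ∧ v ∈ M.sem φ ρ},
      fun _ _ h _ hw => hw.imp fun _ hv => ⟨hv.1, (M.sem φ).monotone h hv.2⟩⟩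
  | .mu X φ => ⟨fun ρ => OrderHom.lfp ⟨fun S => M.sem φ (Function.update ρ X S),
        fun _ _ h => (M.sem φ).monotone (update_le_update_iff.2 ⟨h, fun _ _ => le_rfl⟩)⟩,
      fun _ _ h => OrderHom.lfp.monotone fun S => (M.sem φ).monotone
        (update_le_update_iff.2 ⟨le_refl S, fun j _ => h j⟩)⟩
  | .nu X φ => ⟨fun ρ => OrderHom.gfp ⟨fun S => M.sem φ (Function.update ρ X S),
        fun _ _ h => (M.sem φ).monotone (update_le_update_iff.2 ⟨h, fun _ _ => le_rfl⟩)⟩,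
      fun _ _ h => OrderHom.gfp.monotone fun S => (M.sem φ).monotone
        (update_le_update_iff.2 ⟨le_refl S, fun j _ => h j⟩)⟩

/-- `M, w ⊨ φ`. (Free variables, which do not occur in the formulas below, denote the empty set.) -/
def KModel.Sat {Λ A Vr : Type} [DecidableEq Vr] (M : KModel.{u} Λ A) (w : M.World)
    (φ : MuFormula A Vr Λ) : Prop :=
  w ∈ M.sem φ fun _ => ∅

/-! ## Classes of frames, fusions -/

/-- An isomorphism of unimodal frames. -/
structure UFrame.Iso (F G : UFrame.{u}) where
  toEquiv : F.World ≃ G.World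
  rel_iff : ∀ x y, F.Rel () x y ↔ G.Rel () (toEquiv x) (toEquiv y)

/-- The disjoint union of a family of unimodal frames. -/
def UFrame.disjointUnion {I : Type u} (F : I → UFrame.{u}) : UFrame.{u} where
  World := Σ i, (F i).World
  Rel _ x y := ∃ (i : I) (a b : (F i).World), x = ⟨i, a⟩ ∧ y = ⟨i, b⟩ ∧ (F i).Rel () a b

def ClosedUnderIso (C : Set UFrame.{u}) : Prop :=
  ∀ F G : UFrame.{u}, F ∈ C → Nonempty (UFrame.Iso F G) → G ∈ C

def ClosedUnderDisjointUnion (C : Set UFrame.{u}) : Prop :=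
  ∀ (I : Type u) [Nonempty I] (F : I → UFrame.{u}), (∀ i, F i ∈ C) → UFrame.disjointUnion F ∈ C

/-- The unimodal frame of the `i`-th relation. -/
def KFrame.reduct {Λ : Type} (F : KFrame.{u} Λ) (i : Λ) : UFrame.{u} where
  World := F.World
  Rel _ := F.Rel i

/-- The class `C₀ ⊗ C₁` of bimodal frames, the signatures being `{0}` and `{1}`. -/
def fusion (C₀ C₁ : Set UFrame.{u}) : Set (KFrame.{u} (Fin 2)) :=
  {F | F.reduct 0 ∈ C₀ ∧ F.reduct 1 ∈ C₁}

/-- An occurrence of `∘ ← ∘ → ∘` in a unimodal frame. -/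
structure Fork (F : UFrame.{u}) where
  w0 : F.World
  w1 : F.World
  w2 : F.World
  ne01 : w0 ≠ w1
  ne02 : w0 ≠ w2
  ne12 : w1 ≠ w2
  rel01 : F.Rel () w0 w1
  rel02 : F.Rel () w0 w2

/-- An occurrence of `∘ → ∘` in a unimodal frame. -/
structure Arrow (F : UFrame.{u}) where
  u0 : F.World
  u1 : F.World
  ne01 : u0 ≠ u1
  rel01 : F.Rel () u0 u1

/-! ## Parity games -/

inductive Player : Type
  | eloise
  | abelard

/-- A parity game with set of vertices `V`; the set of vertices owned by player ∃ (`eloise`) is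
`V_∃` and its complement, owned by player ∀ (`abelard`), is `V_∀`. -/
structure ParityGame (V : Type u) where
  owner : V → Player
  init : V
  E : V → V → Prop
  parity : V → ℕ
  parity_bdd : ∃ N, ∀ v, parity v < N

namespace ParityGame

variable {V : Type u} (P : ParityGame V)

/-- A strategy for ∃: a function from `V_∃` to the vertices. -/
abbrev Strategy := {v : V // P.owner v = .eloise} → V

/-- The strategy makes an admissible move wherever there is one. -/
def Legal (σ : P.Strategy) : Prop :=
  ∀ v : {v : V // P.owner v = .eloise}, (∃ w, P.E v w) → P.E v (σ v)

/-- `ρ 0, …, ρ N` is a finite play: the player to move at `ρ N` has no available move. -/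
def IsFinitePlay (N : ℕ) (ρ : ℕ → V) : Prop :=
  ρ 0 = P.init ∧ (∀ i < N, P.E (ρ i) (ρ (i + 1))) ∧ ∀ w, ¬ P.E (ρ N) w

def IsInfinitePlay (ρ : ℕ → V) : Prop :=
  ρ 0 = P.init ∧ ∀ i, P.E (ρ i) (ρ (i + 1))

/-- The greatest parity which appears infinitely often in `ρ` is even. -/
def ParityCondition (ρ : ℕ → V) : Prop :=
  ∃ k, Even k ∧ (∃ᶠ i in Filter.atTop, P.parity (ρ i) = k) ∧
    ∀ m, k < m → ¬ ∃ᶠ i in Filter.atTop, P.parity (ρ i) = m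

/-- All plays in which ∃ follows `σ` are winning for ∃. -/
def IsWinning (σ : P.Strategy) : Prop :=
  P.Legal σ ∧
  (∀ N ρ, P.IsFinitePlay N ρ →
    (∀ i < N, ∀ h : P.owner (ρ i) = .eloise, ρ (i + 1) = σ ⟨ρ i, h⟩) →
    P.owner (ρ N) = .abelard) ∧
  (∀ ρ, P.IsInfinitePlay ρ →
    (∀ i, ∀ h : P.owner (ρ i) = .eloise, ρ (i + 1) = σ ⟨ρ i, h⟩) →
    P.ParityCondition ρ)

/-- Player ∃ wins the parity game. -/
def EloiseWins : Prop := ∃ σ : P.Strategy, P.IsWinning σ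

/-- Every vertex has at most one predecessor. -/
def PredUnique : Prop := ∀ v u u', P.E u v → P.E u' v → u = u'

/-- The paths in `P` from the initial vertex to a given vertex. -/
inductive Path : V → Type u
  | nil : Path P.init
  | snoc {v w : V} (p : Path v) (h : P.E v w) : Path w

/-- The unfolding of a parity game into a tree: every move leads to a fresh copy of a vertex. -/
def unfold : ParityGame (Σ v, P.Path v) where
  owner x := P.owner x.1
  init := ⟨P.init, .nil⟩
  E x y := ∃ h : P.E x.1 y.1, y.2 = .snoc x.2 h
  parity x := P.parity x.1
  parity_bdd := P.parity_bdd.imp fun _ h x => h x.1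

/-- An enumeration without repetition of the finitely many successors of every vertex. -/
structure SuccEnum where
  list : V → List V
  nodup : ∀ v, (list v).Nodup
  mem_iff : ∀ v w, w ∈ list v ↔ P.E v w

end ParityGame

/-! ## The Kripke model of a parity game

All copies of `F₀` and `F₁` are named by one of their worlds, the *entry*, which is the point `w0`
of a copy of `F₀` and the point `u0` of a copy of `F₁`. -/

/-- Names of worlds: the world of a vertex, the point `a` of the copy of `F₀` with entry `x`,
the point `b` of the copy of `F₁` with entry `x`. -/
inductive WName (V A B : Type u) : Type u
  | vert (v : V)
  | pt0 (x : WName V A B) (a : A)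
  | pt1 (x : WName V A B) (b : B)

namespace ParityGame

section Encoding

variable {V : Type u} {P : ParityGame V} (e : P.SuccEnum)
  {F₀ F₁ : UFrame.{u}} (f : Fork F₀) (g : Arrow F₁)

open Classical in
/-- The successors among which a choice is still to be made at a world. At the world of `v` these
are all successors of `v`. If three or more are left at `x`, then the branch `w1` of the copy of
`F₀` at `x` is for the first of them, and the branch `w2`, once it has been confirmed by a copy of
`F₁`, leads to a new world where the others are left. -/
noncomputable def pending : WName V F₀.World F₁.World → List V
  | .vert v => e.list v
  | .pt1 (.pt0 x a) b =>
      if a = f.w2 ∧ b = g.u1 ∧ 3 ≤ (pending x).length then (pending x).tail else []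
  | _ => []

open Classical in
/-- The vertex, if any, whose world is the point `u1` of the copy of `F₁` with entry the given
world: the choice of the branch `w1` at `x` is the choice of the first successor left at `x`; if
exactly two are left, the choice of the branch `w2` is the choice of the second one. -/
noncomputable def dest : WName V F₀.World F₁.World → Option V
  | .pt0 x a =>
      if a = f.w1 then (pending e f g x).head?
      else if a = f.w2 ∧ (pending e f g x).length = 2 then (pending e f g x)[1]? else none
  | _ => none

/-- Entries of copies of `F₀`: all worlds that were not added as points of a copy of `F₀`. -/
def IsEntry0 {A B : Type u} : WName V A B → Prop
  | .vert _ => True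
  | .pt0 _ _ => False
  | .pt1 _ _ => True

/-- Entries of copies of `F₁`: all worlds that were added as points of a copy of `F₀`, and the
worlds of the vertices which no move leads to. -/
def IsEntry1 {A B : Type u} (P : ParityGame V) : WName V A B → Prop
  | .vert v => ∀ u, ¬ P.E u v
  | .pt0 _ _ => True
  | .pt1 _ _ => False

open Classical in
/-- The point `a` of the copy of `F₀` with entry `x`. -/
noncomputable def point0 (x : WName V F₀.World F₁.World) (a : F₀.World) :
    WName V F₀.World F₁.World :=
  if a = f.w0 then x else .pt0 x a

open Classical in
/-- The point `b` of the copy of `F₁` with entry `x`. -/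
noncomputable def point1 (x : WName V F₀.World F₁.World) (b : F₁.World) :
    WName V F₀.World F₁.World :=
  if b = g.u0 then x else
    if b = g.u1 then
      match dest e f g x with
      | some v => .vert v
      | none => .pt1 x b
    else .pt1 x b

/-- The names that are in use. -/
def IsWorld : WName V F₀.World F₁.World → Prop
  | .vert _ => True
  | .pt0 x a => IsWorld x ∧ IsEntry0 x ∧ a ≠ f.w0
  | .pt1 x b => IsWorld x ∧ IsEntry1 P x ∧ b ≠ g.u0 ∧ ¬ (b = g.u1 ∧ (dest e f g x).isSome)

/-- The frame of the model: all copies of `F₀` make up the relation `0`, all copies of `F₁` make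
up the relation `1`. -/
def encodeFrame : KFrame.{u} (Fin 2) where
  World := {x : WName V F₀.World F₁.World // IsWorld e f g x}
  Rel i x y :=
    match i with
    | 0 => ∃ (z : WName V F₀.World F₁.World) (a b : F₀.World), IsWorld e f g z ∧ IsEntry0 z ∧
        x.1 = point0 f z a ∧ y.1 = point0 f z b ∧ F₀.Rel () a b
    | 1 => ∃ (z : WName V F₀.World F₁.World) (a b : F₁.World), IsWorld e f g z ∧ IsEntry1 P z ∧
        x.1 = point1 e f g z a ∧ y.1 = point1 e f g z b ∧ F₁.Rel () a b

/-- The world corresponding to a vertex. -/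
def vertWorld (v : V) : (encodeFrame e f g).World := ⟨.vert v, trivial⟩

/-- The ends of the branches of the copies of `F₀` that are used to represent the moves. If only
one successor is left, then the branch `w2` is not used. -/
def IsBranch (y : WName V F₀.World F₁.World) : Prop :=
  ∃ x, (y = .pt0 x f.w1 ∧ 1 ≤ (pending e f g x).length) ∨
    (y = .pt0 x f.w2 ∧ 2 ≤ (pending e f g x).length)

end Encoding

end ParityGame

/-- The propositional symbols of the encoding. -/
inductive GameProp : Type
  | bd
  | pos
  | pre0
  | pre1
  | nxt0
  | nxt1
  | own (p : Player)
  | par (j : ℕ)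

namespace ParityGame

/-- The Kripke model of a parity game. -/
def encode {V : Type u} {P : ParityGame V} (e : P.SuccEnum) {F₀ F₁ : UFrame.{u}} (f : Fork F₀)
    (g : Arrow F₁) : KModel.{u} (Fin 2) GameProp where
  toKFrame := encodeFrame e f g
  val
    | .bd => {x | (∃ v, x.1 = .vert v) ∨ pending e f g x.1 ≠ [] ∨ IsBranch e f g x.1}
    | .pos => {x | ∃ v, x.1 = .vert v}
    | .pre0 => {x | pending e f g x.1 ≠ []}
    | .nxt0 => {x | IsBranch e f g x.1}
    | .pre1 => {x | IsBranch e f g x.1}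
    | .nxt1 => {x | (∃ u v, P.E u v ∧ x.1 = .vert v) ∨
        ((¬ ∃ v, x.1 = .vert v) ∧ pending e f g x.1 ≠ [])}
    | .own p => {x | ∃ v, x.1 = .vert v ∧ P.owner v = p}
    | .par j => {x | ∃ v, x.1 = .vert v ∧ P.parity v = j}

end ParityGame

/-! ## The winning region formulas -/

/-- Formulas over the propositional symbols of the encoding, with variables `X_j` (`some j`) and
a further variable `Y` (`none`). -/
abbrev GFormula := MuFormula GameProp (Option ℕ) (Fin 2)

namespace GFormula

/-- `(Y ∧ ¬pos) ∨ (φ ∧ pos)` -/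
def continueOr (φ : GFormula) : GFormula :=
  .or (.and (.var none) (.nprop .pos)) (.and φ (.prop .pos))

/-- `νY. pre₀ ∧ bd ∧ ◇₀(nxt₀ ∧ pre₁ ∧ bd ∧ ◇₁(nxt₁ ∧ bd ∧ ((Y ∧ ¬pos) ∨ (φ ∧ pos))))`, for `φ`
without free occurrences of `Y`. -/
def blackDia (φ : GFormula) : GFormula :=
  .nu none (.and (.prop .pre0) (.and (.prop .bd)
    (.dia 0 (.and (.prop .nxt0) (.and (.prop .pre1) (.and (.prop .bd)
      (.dia 1 (.and (.prop .nxt1) (.and (.prop .bd) (continueOr φ))))))))))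

/-- `νY. pre₀ ∧ bd → □₀(nxt₀ ∧ pre₁ ∧ bd → □₁(nxt₁ ∧ bd → ((Y ∧ ¬pos) ∨ (φ ∧ pos))))`, for `φ`
without free occurrences of `Y`; the implications, whose premises are conjunctions of
propositional symbols, are written with negated symbols and disjunctions. -/
def blackBox (φ : GFormula) : GFormula :=
  .nu none (.or (.nprop .pre0) (.or (.nprop .bd)
    (.box 0 (.or (.nprop .nxt0) (.or (.nprop .pre1) (.or (.nprop .bd)
      (.box 1 (.or (.nprop .nxt1) (.or (.nprop .bd) (continueOr φ))))))))))

/-- `(P_j ∧ P_∃ ∧ ⬧X_j) ∨ (P_j ∧ P_∀ ∧ ◼X_j)` -/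
def disjunct (j : ℕ) : GFormula :=
  .or (.and (.prop (.par j)) (.and (.prop (.own .eloise)) (blackDia (.var (some j)))))
    (.and (.prop (.par j)) (.and (.prop (.own .abelard)) (blackBox (.var (some j)))))

/-- The disjunction of `disjunct j` for `0 ≤ j ≤ n`. -/
def matrix : ℕ → GFormula
  | 0 => disjunct 0
  | n + 1 => .or (matrix n) (disjunct (n + 1))

/-- `ηX_k. φ`, where `η` is `ν` for even `k` and `μ` for odd `k`. -/
def bind (k : ℕ) (φ : GFormula) : GFormula :=
  if Even k then .nu (some k) φ else .mu (some k) φ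

/-- `ηX_n … νX₂ μX₁ νX₀. φ` -/
def binds : ℕ → GFormula → GFormula
  | 0, φ => bind 0 φ
  | n + 1, φ => bind (n + 1) (binds n φ)

end GFormula

/-- The winning region formula `W_n`. -/
def winFormula (n : ℕ) : GFormula := GFormula.binds n (GFormula.matrix n)

/-!
The proof has three independent parts.

*Games and fixed points.* Let `nestOp P.step (n + 1)` be the operator `ηX_n … μX_1 νX_0` of the
one-step operator of the game, which maps `X_0, X_1, …` to the set of vertices from which ∃ can
force the next vertex to be in `X_j`, where `j` is the parity of the current one. For every `k`,
the fixed point `nestOp P.step k ρ` is the greatest set which some *positional* strategy `σ` of ∃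
secures (`Secures`): the play stays in the set while parities are below `k`, leaves it for `ρ j`
after a parity `j ≥ k`, and is won if it goes on forever without such a parity. Both halves are
inductions on `k`, with an easy case for `ν`. For `μ`, the strategies for the stages of the
transfinite iteration are combined into a single one (`exists_secures_lfp`); conversely, if a
secured set is not contained in the least fixed point, then some play which follows the strategy
meets the odd parity `k` infinitely often and no greater one (`Secures.subset_nestOp`). Hence ∃
wins iff the initial vertex is in the fixed point (`init_mem_nestOp_iff`). Preimages preserve all
unions and intersections, so they commute with least and greatest fixed points (`preimage_lfp`,
`preimage_gfp`). Applied to the map which sends a path to its last vertex, this shows that a game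
and its unfolding have the same winner.

*The formula.* At a world where the choice from a list of successors is made, `⬧X_j` says that
some element of the list has its world in `X_j`, and `◼X_j` says that all of them have, by
induction on the length of the list. So at the worlds of vertices the body of `W_n` is the
one-step operator of the game, and as preimages under the map from vertices to worlds commute with
fixed points, `W_n` is the nested fixed point.

*The frame.* Every world is in exactly one copy of `F₀`. If vertices have at most one predecessor,
then every world is in exactly one copy of `F₁`, as the world of `v` determines the branch of the
copy of `F₀` which leads to it (`dest_injective`). So both reducts are isomorphic to disjoint
unions of copies of a frame in the class (`mem_of_bijective_points`).
-/

/-! ### Fixed points of monotone set operators -/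

/-- Preimages commute with least fixed points, for an arbitrary map, because they preserve arbitrary
unions and intersections. -/
theorem preimage_lfp {α β : Type*} (ι : α → β) (F : Set β →o Set β) (G : Set α →o Set α)
    (h : ∀ S, ι ⁻¹' F S = G (ι ⁻¹' S)) : ι ⁻¹' F.lfp = G.lfp := by
  apply le_antisymm
  · have : F.lfp ≤ {y | ∀ x, ι x = y → x ∈ G.lfp} := by
      apply OrderHom.lfp_le
      rintro _ hy x rfl
      rw [← G.map_lfp]
      have hx : x ∈ ι ⁻¹' F {y | ∀ x, ι x = y → x ∈ G.lfp} := hy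
      rw [h] at hx
      exact G.monotone (fun z (hz : ∀ x, ι x = ι z → x ∈ G.lfp) => hz z rfl) hx
    exact fun x hx => this hx x rfl
  · apply OrderHom.lfp_le
    rw [← h, F.map_lfp]

/-- The dual of `preimage_lfp`. -/
theorem preimage_gfp {α β : Type*} (ι : α → β) (F : Set β →o Set β) (G : Set α →o Set α)
    (h : ∀ S, ι ⁻¹' F S = G (ι ⁻¹' S)) : ι ⁻¹' F.gfp = G.gfp := by
  apply le_antisymm
  · apply OrderHom.le_gfp
    rw [← h, F.map_gfp]
  · have : ι '' G.gfp ≤ F.gfp := by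
      apply OrderHom.le_gfp
      rintro _ ⟨x, hx, rfl⟩
      change x ∈ ι ⁻¹' F (ι '' G.gfp)
      rw [h]
      rw [← G.map_gfp] at hx
      exact G.monotone (Set.subset_preimage_image ι _) hx
    exact fun x hx => this ⟨x, hx, rfl⟩

/-- The elements of a least fixed point are ranked by the stage of the transfinite iteration at
which they appear. -/
theorem exists_rank_lfp {α : Type u} (F : Set α →o Set α) :
    ∃ r : α → Ordinal.{u}, ∀ a, F {x | x ∈ F.lfp ∧ r x < a} = {x | x ∈ F.lfp ∧ r x ≤ a} := by
  let A := OrdinalApprox.lfpApprox F ⊥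
  have mem_A {a x} : x ∈ A a ↔ ∃ b < a, x ∈ F (A b) := by
    simp only [A]
    rw [OrdinalApprox.lfpApprox]
    simp
  obtain ⟨c, hc⟩ := OrdinalApprox.lfp_mem_range_lfpApprox F
  have A_le (a) : A a ≤ F.lfp :=
    OrdinalApprox.lfpApprox_le_of_mem_fixedPoints F F.isFixedPt_lfp bot_le a
  let r : α → Ordinal.{u} := fun x => sInf {a | x ∈ F (A a)}
  have r_le {a x} (h : x ∈ F (A a)) : r x ≤ a := csInf_le' h
  have mem_r {x} (h : x ∈ F.lfp) : x ∈ F (A (r x)) := by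
    rw [← hc] at h
    obtain ⟨b, -, hb⟩ := mem_A.1 h
    exact csInf_mem (s := {a | x ∈ F (A a)}) ⟨b, hb⟩
  refine ⟨r, fun a => ?_⟩
  have hA : {x | x ∈ F.lfp ∧ r x < a} = A a := by
    ext x
    refine ⟨fun h => mem_A.2 ⟨r x, h.2, mem_r h.1⟩, fun h => ⟨A_le a h, ?_⟩⟩
    obtain ⟨b, hb, hx⟩ := mem_A.1 h
    exact (r_le hx).trans_lt hb
  rw [hA]
  ext x
  refine ⟨fun h => ⟨?_, r_le h⟩, fun h => ?_⟩
  · rw [← F.map_lfp]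
    exact F.monotone (A_le a) h
  · exact F.monotone (OrdinalApprox.lfpApprox_mono_right F h.2) (mem_r h.1)

/-- The operator `Φ` on valuations of the variables `X_0, X_1, …`, as a function of the value of
`X_k` only. -/
def bodyOp {α : Type*} (k : ℕ) (Φ : (ℕ → Set α) →o Set α) (ρ : ℕ → Set α) : Set α →o Set α :=
  ⟨fun S => Φ (Function.update ρ k S),
    fun _ _ h => Φ.monotone (update_le_update_iff.2 ⟨h, fun _ _ => le_rfl⟩)⟩

theorem bodyOp_mono {α : Type*} (k : ℕ) (Φ : (ℕ → Set α) →o Set α) : Monotone (bodyOp k Φ) :=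
  fun _ _ h S => Φ.monotone (update_le_update_iff.2 ⟨le_refl S, fun j _ => h j⟩)

/-- The operator `ηX_k. Φ`, where `η` is `ν` for even `k` and `μ` for odd `k`. -/
def bindOp {α : Type*} (k : ℕ) (Φ : (ℕ → Set α) →o Set α) : (ℕ → Set α) →o Set α where
  toFun ρ := if Even k then (bodyOp k Φ ρ).gfp else (bodyOp k Φ ρ).lfp
  monotone' _ _ h := by
    dsimp only
    split_ifs
    · exact OrderHom.gfp.monotone (bodyOp_mono k Φ h)
    · exact OrderHom.lfp.monotone (bodyOp_mono k Φ h)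

/-- The operator `ηX_{k-1} … νX_2 μX_1 νX_0. Φ`. -/
def nestOp {α : Type*} (Φ : (ℕ → Set α) →o Set α) : ℕ → ((ℕ → Set α) →o Set α)
  | 0 => Φ
  | k + 1 => bindOp k (nestOp Φ k)

theorem bindOp_even {α : Type*} {k : ℕ} (hk : Even k) (Φ : (ℕ → Set α) →o Set α)
    (ρ : ℕ → Set α) : bindOp k Φ ρ = (bodyOp k Φ ρ).gfp :=
  if_pos hk

theorem bindOp_odd {α : Type*} {k : ℕ} (hk : ¬ Even k) (Φ : (ℕ → Set α) →o Set α)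
    (ρ : ℕ → Set α) : bindOp k Φ ρ = (bodyOp k Φ ρ).lfp :=
  if_neg hk

theorem bindOp_update {α : Type*} (k : ℕ) (Φ : (ℕ → Set α) →o Set α) (ρ : ℕ → Set α) :
    Φ (Function.update ρ k (bindOp k Φ ρ)) = bindOp k Φ ρ := by
  by_cases hk : Even k
  · rw [bindOp_even hk]
    exact (bodyOp k Φ ρ).map_gfp
  · rw [bindOp_odd hk]
    exact (bodyOp k Φ ρ).map_lfp

theorem preimage_update {α β : Type*} (ι : α → β) (ρ : ℕ → Set β) (k : ℕ) (S : Set β) :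
    (fun j => ι ⁻¹' Function.update ρ k S j) =
      Function.update (fun j => ι ⁻¹' ρ j) k (ι ⁻¹' S) := by
  ext j : 1
  exact Function.apply_update (fun _ => Set.preimage ι) ρ k S j

theorem preimage_bodyOp {α β : Type*} (ι : α → β) (k : ℕ) {Φ : (ℕ → Set β) →o Set β}
    {Ψ : (ℕ → Set α) →o Set α} (h : ∀ ρ, ι ⁻¹' Φ ρ = Ψ fun j => ι ⁻¹' ρ j) (ρ : ℕ → Set β)
    (S : Set β) : ι ⁻¹' bodyOp k Φ ρ S = bodyOp k Ψ (fun j => ι ⁻¹' ρ j) (ι ⁻¹' S) :=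
  (h _).trans (congrArg Ψ (preimage_update ι ρ k S))

theorem preimage_bindOp {α β : Type*} (ι : α → β) (k : ℕ) {Φ : (ℕ → Set β) →o Set β}
    {Ψ : (ℕ → Set α) →o Set α} (h : ∀ ρ, ι ⁻¹' Φ ρ = Ψ fun j => ι ⁻¹' ρ j) (ρ : ℕ → Set β) :
    ι ⁻¹' bindOp k Φ ρ = bindOp k Ψ fun j => ι ⁻¹' ρ j := by
  by_cases hk : Even k
  · rw [bindOp_even hk, bindOp_even hk]
    exact preimage_gfp _ _ _ (preimage_bodyOp ι k h ρ)
  · rw [bindOp_odd hk, bindOp_odd hk]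
    exact preimage_lfp _ _ _ (preimage_bodyOp ι k h ρ)

theorem preimage_nestOp {α β : Type*} (ι : α → β) {Φ : (ℕ → Set β) →o Set β}
    {Ψ : (ℕ → Set α) →o Set α} (h : ∀ ρ, ι ⁻¹' Φ ρ = Ψ fun j => ι ⁻¹' ρ j) (k : ℕ)
    (ρ : ℕ → Set β) : ι ⁻¹' nestOp Φ k ρ = nestOp Ψ k fun j => ι ⁻¹' ρ j := by
  induction k generalizing ρ with
  | zero => exact h ρ
  | succ k ih => exact preimage_bindOp ι k ih ρ

namespace ParityGame

variable {V : Type u} (P : ParityGame V)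

/-! ### Positional strategies and nested fixed points -/

/-- The operator mapping sets `X_0, X_1, …` to the set of vertices `v` from which ∃ can make sure
that the next vertex exists, if it is up to ∃, and belongs to `X_j`, where `j` is the parity of
`v`. -/
def step : (ℕ → Set V) →o Set V where
  toFun ρ := {v | (P.owner v = .eloise ∧ ∃ w, P.E v w ∧ w ∈ ρ (P.parity v)) ∨
    (P.owner v = .abelard ∧ ∀ w, P.E v w → w ∈ ρ (P.parity v))}
  monotone' _ _ h _ := Or.imp (And.imp_right fun ⟨w, hE, hw⟩ => ⟨w, hE, h _ hw⟩)
    (And.imp_right fun hv w hE => h _ (hv w hE))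

/-- The moves from a vertex to another one in which ∃ follows `σ`. -/
def Follow (σ : V → V) (v w : V) : Prop :=
  P.E v w ∧ (P.owner v = .eloise → w = σ v)

/-- On `S`, the positional strategy `σ` always provides a move for ∃; if ∃ follows it, then the play
stays in `S` while parities are below `k` and goes from a vertex of parity `j ≥ k` to an element of
`ρ j`; and ∃ wins the infinite plays which stay in `S` and have parities below `k` only. -/
structure Secures (k : ℕ) (ρ : ℕ → Set V) (S : Set V) (σ : V → V) : Prop where
  legal : ∀ v ∈ S, P.owner v = .eloise → P.E v (σ v)
  stay : ∀ v ∈ S, P.parity v < k → ∀ w, P.Follow σ v w → w ∈ S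
  exit : ∀ v ∈ S, k ≤ P.parity v → ∀ w, P.Follow σ v w → w ∈ ρ (P.parity v)
  wins : ∀ s : ℕ → V, (∀ i, s i ∈ S) → (∀ i, P.parity (s i) < k) →
    (∀ i, P.Follow σ (s i) (s (i + 1))) → P.ParityCondition s

variable {P}

theorem frequently_shift_iff (p : ℕ → Prop) (N : ℕ) :
    (∃ᶠ i in Filter.atTop, p (i + N)) ↔ ∃ᶠ i in Filter.atTop, p i := by
  conv_rhs => rw [← Filter.map_add_atTop_eq_nat N, Filter.frequently_map]

theorem parityCondition_shift {s : ℕ → V} (N : ℕ) :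
    P.ParityCondition (fun i => s (i + N)) ↔ P.ParityCondition s := by
  have h (m : ℕ) := frequently_shift_iff (fun i => P.parity (s i) = m) N
  simp only [ParityCondition, h]

theorem parityCondition_of_frequently {s : ℕ → V} {k : ℕ} (hk : Even k)
    (hle : ∀ i, P.parity (s i) ≤ k) (hf : ∃ᶠ i in Filter.atTop, P.parity (s i) = k) :
    P.ParityCondition s :=
  ⟨k, hk, hf, fun _ hm h => h (Filter.Eventually.of_forall fun i hi =>
    absurd (hle i) (by omega))⟩

theorem not_parityCondition_of_frequently {s : ℕ → V} {k : ℕ} (hk : ¬ Even k)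
    (hle : ∀ i, P.parity (s i) ≤ k) (hf : ∃ᶠ i in Filter.atTop, P.parity (s i) = k) :
    ¬ P.ParityCondition s := by
  rintro ⟨m, hm, hfm, hmax⟩
  obtain ⟨i, hi⟩ := hfm.exists
  have : m ≤ k := hi ▸ hle i
  have hne : m ≠ k := by rintro rfl; exact hk hm
  exact hmax k (by omega) hf

theorem exists_secures_zero (ρ : ℕ → Set V) : ∃ σ, P.Secures 0 ρ (P.step ρ) σ := by
  classical
  have h (v : V) : ∃ w, v ∈ P.step ρ → P.owner v = .eloise → P.E v w ∧ w ∈ ρ (P.parity v) := by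
    by_cases hv : v ∈ P.step ρ ∧ P.owner v = .eloise
    · rcases hv.1 with ⟨-, w, hw⟩ | ⟨h, -⟩
      · exact ⟨w, fun _ _ => hw⟩
      · rw [hv.2] at h
        cases h
    · exact ⟨v, fun h h' => absurd ⟨h, h'⟩ hv⟩
  choose σ hσ using h
  refine ⟨σ, fun v hv h => (hσ v hv h).1, fun v _ h => absurd h (by omega), ?_,
    fun s _ h => absurd (h 0) (by omega)⟩
  intro v hv _ w hw
  rcases ho : P.owner v with _ | _
  · rw [hw.2 ho]
    exact (hσ v hv ho).2
  · rcases hv with ⟨h, -⟩ | ⟨-, h⟩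
    · rw [ho] at h
      cases h
    · exact h w hw.1

/-- If the bound variable is replaced by the fixed point, then a strategy for the body is one for
the greatest fixed point. -/
theorem Secures.gfp {k : ℕ} (hk : Even k) {ρ : ℕ → Set V} {S : Set V} {σ : V → V}
    (h : P.Secures k (Function.update ρ k S) S σ) : P.Secures (k + 1) ρ S σ := by
  refine ⟨h.legal, fun v hv hlt w hw => ?_, fun v hv hle w hw => ?_, fun s hS hlt hs => ?_⟩
  · rcases Nat.lt_succ_iff_lt_or_eq.1 hlt with hlt | heq
    · exact h.stay v hv hlt w hw
    · have := h.exit v hv heq.ge w hw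
      rwa [heq, Function.update_self] at this
  · have := h.exit v hv (by omega) w hw
    rwa [Function.update_of_ne (by omega)] at this
  · by_cases hf : ∃ᶠ i in Filter.atTop, P.parity (s i) = k
    · exact parityCondition_of_frequently hk (fun i => Nat.le_of_lt_succ (hlt i)) hf
    · obtain ⟨N, hN⟩ := Filter.eventually_atTop.1 (Filter.not_frequently.1 hf)
      rw [← parityCondition_shift N]
      refine h.wins _ (fun i => hS _) (fun i => ?_) fun i => ?_
      · have := hlt (i + N)
        have := hN (i + N) (by omega)
        omega
      · have := hs (i + N)
        rwa [show i + N + 1 = i + 1 + N by omega] at this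

/-- Strategies for the stages of the iteration towards a least fixed point are combined into one by
following, at each vertex, the strategy for the stage at which this vertex appears. Along a play the
stage never increases, and it decreases at the vertices of parity `k`. -/
theorem exists_secures_lfp {k : ℕ} {Φ : (ℕ → Set V) →o Set V} {ρ : ℕ → Set V}
    (hk : ¬ Even k) (h : ∀ S, ∃ σ, P.Secures k (Function.update ρ k S)
      (Φ (Function.update ρ k S)) σ) : ∃ σ, P.Secures (k + 1) ρ (bindOp k Φ ρ) σ := by
  rw [bindOp_odd hk]
  set F := bodyOp k Φ ρ
  obtain ⟨r, hr⟩ := exists_rank_lfp F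
  have key (a : Ordinal.{u}) : ∃ σ, P.Secures k
      (Function.update ρ k {x | x ∈ F.lfp ∧ r x < a}) {x | x ∈ F.lfp ∧ r x ≤ a} σ := by
    rw [← hr a]
    exact h _
  choose τ hτ using key
  have follow {v w} (hw : P.Follow (fun v => τ (r v) v) v w) : P.Follow (τ (r v)) v w := hw
  have hstay {v w} (hv : v ∈ F.lfp) (hlt : P.parity v < k)
      (hw : P.Follow (fun v => τ (r v) v) v w) : w ∈ F.lfp ∧ r w ≤ r v :=
    (hτ (r v)).stay v ⟨hv, le_rfl⟩ hlt w (follow hw)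
  have hdesc {v w} (hv : v ∈ F.lfp) (heq : P.parity v = k)
      (hw : P.Follow (fun v => τ (r v) v) v w) : w ∈ F.lfp ∧ r w < r v := by
    have := (hτ (r v)).exit v ⟨hv, le_rfl⟩ heq.ge w (follow hw)
    rwa [heq, Function.update_self] at this
  refine ⟨fun v => τ (r v) v, fun v hv ho => (hτ (r v)).legal v ⟨hv, le_rfl⟩ ho,
    fun v hv hlt w hw => ?_, fun v hv hle w hw => ?_, fun s hS hlt hs => ?_⟩
  · rcases Nat.lt_succ_iff_lt_or_eq.1 hlt with hlt | heq
    · exact (hstay hv hlt hw).1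
    · exact (hdesc hv heq hw).1
  · have := (hτ (r v)).exit v ⟨hv, le_rfl⟩ (by omega) w (follow hw)
    rwa [Function.update_of_ne (by omega)] at this
  · have hanti : Antitone fun i => r (s i) := antitone_nat_of_succ_le fun i => by
      rcases Nat.lt_succ_iff_lt_or_eq.1 (hlt i) with hi | hi
      · exact (hstay (hS i) hi (hs i)).2
      · exact (hdesc (hS i) hi (hs i)).2.le
    obtain ⟨N, hN⟩ := WellFoundedLT.antitone_chain_condition hanti
    replace hN : ∀ i, r (s (i + N)) = r (s N) := fun i => (hN (i + N) (by omega)).symm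
    rw [← parityCondition_shift N]
    refine (hτ (r (s N))).wins _ (fun i => ⟨hS _, (hN i).le⟩) (fun i => ?_) fun i => ?_
    · rcases Nat.lt_succ_iff_lt_or_eq.1 (hlt (i + N)) with hi | hi
      · exact hi
      · have := (hdesc (hS _) hi (hs _)).2
        rw [show i + N + 1 = i + 1 + N by omega, hN, hN] at this
        exact absurd this (lt_irrefl _)
    · have := follow (hs (i + N))
      rwa [hN, show i + N + 1 = i + 1 + N by omega] at this

theorem exists_secures_nestOp (k : ℕ) (ρ : ℕ → Set V) :
    ∃ σ, P.Secures k ρ (nestOp P.step k ρ) σ := by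
  induction k generalizing ρ with
  | zero => exact exists_secures_zero ρ
  | succ k ih =>
    by_cases hk : Even k
    · obtain ⟨σ, hσ⟩ := ih (Function.update ρ k (nestOp P.step (k + 1) ρ))
      refine ⟨σ, Secures.gfp hk ?_⟩
      rwa [show nestOp P.step k (Function.update ρ k (nestOp P.step (k + 1) ρ)) =
        nestOp P.step (k + 1) ρ from bindOp_update k (nestOp P.step k) ρ] at hσ
    · exact exists_secures_lfp hk fun S => ih _

/-- Suppose that `A m z` says that an element with property `Q` is reached from `z` in `m` steps,
after which one can go on likewise. Then some infinite sequence of steps meets `Q` infinitely often. -/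
theorem exists_seq_frequently {α : Type*} {R : α → α → Prop} {Q : α → Prop} {A : ℕ → α → Prop}
    (zero : ∀ z, A 0 z → Q z ∧ ∃ y m, R z y ∧ A m y)
    (succ : ∀ m z, A (m + 1) z → ∃ y, R z y ∧ A m y) {m : ℕ} {z : α} (hz : A m z) :
    ∃ s : ℕ → α, s 0 = z ∧ (∀ i, R (s i) (s (i + 1))) ∧ (∀ i, ∃ m, A m (s i)) ∧
      ∃ᶠ i in Filter.atTop, Q (s i) := by
  have next (p : {p : ℕ × α // A p.1 p.2}) : ∃ q : {p : ℕ × α // A p.1 p.2},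
      R p.1.2 q.1.2 ∧ (p.1.1 = 0 → Q p.1.2) ∧ (p.1.1 ≠ 0 → p.1.1 = q.1.1 + 1) := by
    obtain ⟨⟨m, z⟩, hz⟩ := p
    cases m with
    | zero =>
      obtain ⟨hQ, y, m, hR, hy⟩ := zero z hz
      exact ⟨⟨(m, y), hy⟩, hR, fun _ => hQ, fun h => absurd rfl h⟩
    | succ m =>
      obtain ⟨y, hR, hy⟩ := succ m z hz
      exact ⟨⟨(m, y), hy⟩, hR, fun h => absurd h (by simp), fun _ => rfl⟩
  choose nx hR hQ hd using next
  let t : ℕ → {p : ℕ × α // A p.1 p.2} := fun i => nx^[i] ⟨(m, z), hz⟩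
  have ht (i) : t (i + 1) = nx (t i) := Function.iterate_succ_apply' ..
  refine ⟨fun i => (t i).1.2, rfl, fun i => ?_, fun i => ⟨_, (t i).2⟩, ?_⟩
  · simp only [ht]
    exact hR _
  · rw [Filter.frequently_atTop]
    intro i
    induction hm : (t i).1.1 generalizing i with
    | zero => exact ⟨i, le_rfl, hQ _ hm⟩
    | succ m ih =>
      have := hd (t i) (by omega)
      obtain ⟨j, hj, hQj⟩ := ih (i + 1) (by rw [ht]; omega)
      exact ⟨j, by omega, hQj⟩

/-- `P.Reach σ k S B m v`: following `σ` within the vertices of `S` of parity at most `k`, one gets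
in `m` steps from `v` to a vertex of parity `k` from which a further step may lead to `B`. -/
def Reach (P : ParityGame V) (σ : V → V) (k : ℕ) (S B : Set V) : ℕ → V → Prop
  | 0, v => v ∈ S ∧ P.parity v = k ∧ ∃ w, P.Follow σ v w ∧ w ∈ B
  | m + 1, v => v ∈ S ∧ P.parity v ≤ k ∧ ∃ w, P.Follow σ v w ∧ P.Reach σ k S B m w

theorem Reach.mem {σ : V → V} {k : ℕ} {S B : Set V} {m : ℕ} {v : V}
    (h : P.Reach σ k S B m v) : v ∈ S ∧ P.parity v ≤ k := by
  cases m with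
  | zero => exact ⟨h.1, h.2.1.le⟩
  | succ m => exact ⟨h.1, h.2.1⟩

theorem Secures.subset_nestOp {k : ℕ} {ρ : ℕ → Set V} {S : Set V} {σ : V → V}
    (h : P.Secures k ρ S σ) : S ⊆ nestOp P.step k ρ := by
  induction k generalizing ρ S with
  | zero =>
    intro v hv
    rcases ho : P.owner v with _ | _
    · exact .inl ⟨ho, σ v, h.legal v hv ho,
        h.exit v hv (Nat.zero_le _) _ ⟨h.legal v hv ho, fun _ => rfl⟩⟩
    · exact .inr ⟨ho, fun w hw => h.exit v hv (Nat.zero_le _) _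
        ⟨hw, fun h' => by rw [ho] at h'; cases h'⟩⟩
  | succ k ih =>
    change S ⊆ bindOp k (nestOp P.step k) ρ
    by_cases hk : Even k
    · rw [bindOp_even hk]
      refine OrderHom.le_gfp _ (ih ⟨h.legal, fun v hv hlt => h.stay v hv (by omega),
        fun v hv hle w hw => ?_, fun s hS hlt => h.wins s hS fun i => by have := hlt i; omega⟩)
      rcases hle.eq_or_lt with heq | hlt
      · rw [← heq, Function.update_self]
        exact h.stay v hv (by omega) w hw
      · rw [Function.update_of_ne (by omega)]
        exact h.exit v hv hlt w hw
    · set L := bindOp k (nestOp P.step k) ρ with hL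
      -- From the vertices outside `D`, every vertex of parity `k` which can be reached has all its
      -- successors in `L`, so that `σ` secures them, and they belong to `L` as well.
      let D : Set V := {v | ∃ m, P.Reach σ k S (S \ L) m v}
      have hD : S \ D ⊆ L := by
        rw [hL, ← bindOp_update k]
        refine ih ⟨fun v hv => h.legal v hv.1, fun v hv hlt w hw => ?_, fun v hv hle w hw => ?_,
          fun s hS hlt => h.wins s (fun i => (hS i).1) fun i => by have := hlt i; omega⟩
        · exact ⟨h.stay v hv.1 (by omega) w hw,
            fun ⟨m, hm⟩ => hv.2 ⟨m + 1, hv.1, by omega, w, hw, hm⟩⟩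
        · rcases hle.eq_or_lt with heq | hlt
          · rw [← heq, Function.update_self]
            by_contra hwL
            exact hv.2 ⟨0, hv.1, heq.symm, w, hw, h.stay v hv.1 (by omega) w hw, hwL⟩
          · rw [Function.update_of_ne (by omega)]
            exact h.exit v hv.1 hlt w hw
      -- Hence `S \ L` is contained in `D`, and a play starting there may go on forever in `D` and
      -- meet the odd parity `k` infinitely often.
      intro v hv
      by_contra hvL
      have hBD : ∀ w ∈ S \ L, w ∈ D := fun w hw => by
        by_contra hwD
        exact hw.2 (hD ⟨hw.1, hwD⟩)
      obtain ⟨m, hm⟩ := hBD v ⟨hv, hvL⟩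
      obtain ⟨s, -, hs, hsA, hf⟩ := exists_seq_frequently (R := P.Follow σ)
        (Q := fun v => P.parity v = k) (A := P.Reach σ k S (S \ L))
        (fun z hz => by
          obtain ⟨-, hz, w, hw, hwB⟩ := hz
          obtain ⟨m, hm⟩ := hBD w hwB
          exact ⟨hz, w, m, hw, hm⟩)
        (fun m z hz => hz.2.2) hm
      have hmem (i) : s i ∈ S ∧ P.parity (s i) ≤ k := by
        obtain ⟨m, hm⟩ := hsA i
        exact hm.mem
      exact not_parityCondition_of_frequently hk (fun i => (hmem i).2) hf
        (h.wins s (fun i => (hmem i).1) (fun i => Nat.lt_succ_of_le (hmem i).2) hs)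

/-- The vertices which are reached by plays in which ∃ follows `σ`. -/
def Reachable (P : ParityGame V) (σ : V → V) : Set V :=
  {v | ∃ (N : ℕ) (s : ℕ → V), s 0 = P.init ∧ s N = v ∧ ∀ i < N, P.Follow σ (s i) (s (i + 1))}

/-- The strategy `σ` as a function on all vertices; outside `V_∃`, where `Follow` does not depend on
it, the value is the vertex itself. -/
noncomputable def Strategy.extend (σ : P.Strategy) (v : V) : V :=
  open Classical in if h : P.owner v = .eloise then σ ⟨v, h⟩ else v

theorem Strategy.extend_apply (σ : P.Strategy) {v : V} (h : P.owner v = .eloise) :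
    σ.extend v = σ ⟨v, h⟩ := by
  simp [Strategy.extend, h]

theorem IsWinning.secures {σ : P.Strategy} (h : P.IsWinning σ) {n : ℕ}
    (hn : ∀ v, P.parity v ≤ n) (ρ : ℕ → Set V) :
    P.Secures (n + 1) ρ (P.Reachable σ.extend) σ.extend := by
  obtain ⟨hleg, hfin, hinf⟩ := h
  have conf {v w : V} (hf : P.Follow σ.extend v w) (ho : P.owner v = .eloise) :
      w = σ ⟨v, ho⟩ := by
    rw [← σ.extend_apply ho]
    exact hf.2 ho
  refine ⟨?_, ?_, fun v _ hv => ?_, fun s hS _ hs => ?_⟩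
  · rintro v ⟨N, s, h0, rfl, hs⟩ ho
    rw [σ.extend_apply ho]
    apply hleg ⟨_, ho⟩
    by_contra hne
    have := hfin N s ⟨h0, fun i hi => (hs i hi).1, fun w hw => hne ⟨w, hw⟩⟩
      fun i hi => conf (hs i hi)
    rw [ho] at this
    cases this
  · rintro v ⟨N, s, h0, rfl, hs⟩ - w hw
    refine ⟨N + 1, fun i => if i ≤ N then s i else w, by simpa using h0, by simp, fun i hi => ?_⟩
    rcases Nat.lt_succ_iff_lt_or_eq.1 hi with hi | rfl
    · simpa [hi.le, Nat.succ_le_of_lt hi] using hs i hi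
    · simpa using hw
  · exact absurd (hn v) (by omega)
  · obtain ⟨N, t, h0, hN, ht⟩ := hS 0
    -- the play which arrives at `s 0` after `N` steps and goes on with `s`
    let p : ℕ → V := fun i => if i < N then t i else s (i - N)
    have hp : (fun i => p (i + N)) = s := by
      ext i
      simp [p]
    have hpt (i) (hi : i ≤ N) : p i = t i := by
      rcases hi.lt_or_eq with hi | rfl
      · simp [p, hi]
      · simp [p, hN]
    have hfp (i) : P.Follow σ.extend (p i) (p (i + 1)) := by
      by_cases hi : i < N
      · rw [hpt i hi.le, hpt (i + 1) hi]
        exact ht i hi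
      · have := hs (i - N)
        rw [← hp] at this
        convert this using 2 <;> omega
    rw [← hp, parityCondition_shift]
    exact hinf p ⟨by rw [hpt 0 (Nat.zero_le _), h0], fun i => (hfp i).1⟩ fun i => conf (hfp i)

theorem Secures.eloiseWins {n : ℕ} (hn : ∀ v, P.parity v ≤ n) {ρ : ℕ → Set V} {S : Set V}
    {σ : V → V} (h : P.Secures (n + 1) ρ S σ) (h0 : P.init ∈ S) : P.EloiseWins := by
  classical
  -- the strategy follows `σ` where this is admissible, in particular on `S`
  have hτ (v : V) : ∃ w, ((∃ w, P.E v w) → P.E v w) ∧ (P.E v (σ v) → w = σ v) := by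
    by_cases hv : P.E v (σ v)
    · exact ⟨σ v, fun _ => hv, fun _ => rfl⟩
    · by_cases hw : ∃ w, P.E v w
      · exact ⟨hw.choose, fun _ => hw.choose_spec, fun h => absurd h hv⟩
      · exact ⟨v, fun h => absurd h hw, fun h => absurd h hv⟩
  choose τ hleg hτσ using hτ
  have follow {v w : V} (hv : v ∈ S) (hE : P.E v w) (hw : P.owner v = .eloise → w = τ v) :
      P.Follow σ v w :=
    ⟨hE, fun ho => (hw ho).trans (hτσ v (h.legal v hv ho))⟩
  have hlt (v) : P.parity v < n + 1 := Nat.lt_succ_of_le (hn v)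
  refine ⟨fun v => τ v, fun v => hleg v, fun N s hs hc => ?_, fun s hs hc => ?_⟩
  · have hmem : ∀ i ≤ N, s i ∈ S := by
      intro i hi
      induction i with
      | zero => rwa [hs.1]
      | succ i ih =>
        exact h.stay _ (ih (by omega)) (hlt _) _
          (follow (ih (by omega)) (hs.2.1 i (by omega)) (hc i (by omega)))
    rcases ho : P.owner (s N) with _ | _
    · exact absurd (h.legal _ (hmem N le_rfl) ho) (hs.2.2 _)
    · rfl
  · have hmem : ∀ i, s i ∈ S := by
      intro i
      induction i with
      | zero => rwa [hs.1]
      | succ i ih => exact h.stay _ ih (hlt _) _ (follow ih (hs.2 i) (hc i))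
    exact h.wins s hmem (fun i => hlt _) fun i => follow (hmem i) (hs.2 i) (hc i)

/-- The winning region of ∃ is a nested fixed point. Since the strategies here are positional, this
includes positional determinacy for ∃. -/
theorem init_mem_nestOp_iff {n : ℕ} (hn : ∀ v, P.parity v ≤ n) (ρ : ℕ → Set V) :
    P.init ∈ nestOp P.step (n + 1) ρ ↔ P.EloiseWins := by
  constructor
  · intro h
    obtain ⟨σ, hσ⟩ := exists_secures_nestOp (P := P) (n + 1) ρ
    exact hσ.eloiseWins hn h
  · rintro ⟨σ, hσ⟩
    exact (hσ.secures hn ρ).subset_nestOp ⟨0, fun _ => P.init, rfl, rfl, fun i hi => by omega⟩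

/-! ### Unfoldings -/

theorem preimage_step_unfold (ρ : ℕ → Set V) :
    Sigma.fst ⁻¹' P.step ρ = P.unfold.step fun j => Sigma.fst ⁻¹' ρ j := by
  ext ⟨v, p⟩
  refine or_congr (and_congr_right fun _ => ?_) (and_congr_right fun _ => ?_)
  · exact ⟨fun ⟨w, hE, hw⟩ => ⟨⟨w, .snoc p hE⟩, ⟨hE, rfl⟩, hw⟩,
      fun ⟨y, ⟨hE, _⟩, hy⟩ => ⟨y.1, hE, hy⟩⟩
  · exact ⟨fun h y ⟨hE, _⟩ => h y.1 hE, fun h w hE => h ⟨w, .snoc p hE⟩ ⟨hE, rfl⟩⟩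

theorem unfold_eloiseWins_iff {n : ℕ} (hn : ∀ v, P.parity v ≤ n) :
    P.unfold.EloiseWins ↔ P.EloiseWins := by
  rw [← init_mem_nestOp_iff hn fun _ => ∅,
    ← init_mem_nestOp_iff (P := P.unfold) (fun v => hn v.1) fun _ => Sigma.fst ⁻¹' ∅,
    ← preimage_nestOp Sigma.fst preimage_step_unfold]
  rfl

theorem unfold_predUnique : P.unfold.PredUnique := by
  rintro ⟨v, p⟩ ⟨u, q⟩ ⟨u', q'⟩ ⟨h, hp⟩ ⟨h', hq⟩
  dsimp only at hp hq
  rw [hp] at hq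
  cases hq
  rfl

end ParityGame

namespace GFormula

/-! ### The fixed points of the formula -/

theorem preimage_sem_bind {α : Type u} (M : KModel.{u} (Fin 2) GameProp) (ι : α → M.World) (k : ℕ)
    {φ : GFormula} {Φ : (ℕ → Set α) →o Set α}
    (h : ∀ ρ, ι ⁻¹' M.sem φ ρ = Φ fun j => ι ⁻¹' ρ (some j)) (ρ : Option ℕ → Set M.World) :
    ι ⁻¹' M.sem (bind k φ) ρ = bindOp k Φ fun j => ι ⁻¹' ρ (some j) := by
  have hu (S : Set M.World) : (fun j => ι ⁻¹' Function.update ρ (some k) S (some j)) =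
      Function.update (fun j => ι ⁻¹' ρ (some j)) k (ι ⁻¹' S) := by
    ext j : 1
    by_cases hj : j = k
    · subst hj
      simp
    · rw [Function.update_of_ne hj, Function.update_of_ne (by simpa using hj)]
  have hb (S : Set M.World) : ι ⁻¹' M.sem φ (Function.update ρ (some k) S) =
      bodyOp k Φ (fun j => ι ⁻¹' ρ (some j)) (ι ⁻¹' S) := by
    rw [h, hu]
    rfl
  by_cases hk : Even k
  · rw [bindOp_even hk, bind, if_pos hk]
    exact preimage_gfp ι _ _ hb
  · rw [bindOp_odd hk, bind, if_neg hk]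
    exact preimage_lfp ι _ _ hb

theorem preimage_sem_binds {α : Type u} (M : KModel.{u} (Fin 2) GameProp) (ι : α → M.World)
    {φ : GFormula} {Φ : (ℕ → Set α) →o Set α}
    (h : ∀ ρ, ι ⁻¹' M.sem φ ρ = Φ fun j => ι ⁻¹' ρ (some j)) (n : ℕ)
    (ρ : Option ℕ → Set M.World) :
    ι ⁻¹' M.sem (binds n φ) ρ = nestOp Φ (n + 1) fun j => ι ⁻¹' ρ (some j) := by
  induction n generalizing ρ with
  | zero => exact preimage_sem_bind M ι 0 h ρ
  | succ n ih => exact preimage_sem_bind M ι (n + 1) ih ρ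

end GFormula

namespace ParityGame

variable {V : Type u} {P : ParityGame V} (e : P.SuccEnum)
  {F₀ F₁ : UFrame.{u}} (f : Fork F₀) (g : Arrow F₁)

/-! ### The representation of moves by choices between two alternatives -/

section Pending

variable {e f g}

theorem isEntry0_of_pending {x : WName V F₀.World F₁.World} (h : pending e f g x ≠ []) :
    IsEntry0 x := by
  cases x with
  | vert v => trivial
  | pt0 x a => exact absurd (by simp [pending]) h
  | pt1 x b => trivial

theorem pending_pt1_w2 {x : WName V F₀.World F₁.World} (h : 3 ≤ (pending e f g x).length) :
    pending e f g (.pt1 (.pt0 x f.w2) g.u1) = (pending e f g x).tail := by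
  rw [pending, if_pos ⟨rfl, rfl, h⟩]

theorem dest_w1 (x : WName V F₀.World F₁.World) :
    dest e f g (.pt0 x f.w1) = (pending e f g x).head? := by
  rw [dest, if_pos rfl]

theorem dest_w2 (x : WName V F₀.World F₁.World) :
    dest e f g (.pt0 x f.w2) =
      if (pending e f g x).length = 2 then (pending e f g x)[1]? else none := by
  rw [dest, if_neg f.ne12.symm]
  simp

theorem point1_u1 (x : WName V F₀.World F₁.World) :
    point1 e f g x g.u1 = (dest e f g x).elim (.pt1 x g.u1) .vert := by
  rw [point1, if_neg g.ne01.symm, if_pos rfl]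
  cases dest e f g x <;> rfl

theorem isWorld_pt0 {x : WName V F₀.World F₁.World} (hx : IsWorld e f g x)
    (h : pending e f g x ≠ []) {a : F₀.World} (ha : a ≠ f.w0) : IsWorld e f g (.pt0 x a) :=
  ⟨hx, isEntry0_of_pending h, ha⟩

theorem isWorld_point1 {x : WName V F₀.World F₁.World} (hx : IsWorld e f g x)
    (h : IsEntry1 P x) (b : F₁.World) : IsWorld e f g (point1 e f g x b) := by
  unfold point1
  split_ifs with h0 h1
  · exact hx
  · split
    · trivial
    · rename_i hd
      exact ⟨hx, h, h0, by simp [hd]⟩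
  · exact ⟨hx, h, h0, fun h => h1 h.1⟩

theorem isWorld_point0 {x : WName V F₀.World F₁.World} (hx : IsWorld e f g x)
    (h : IsEntry0 x) (a : F₀.World) : IsWorld e f g (point0 f x a) := by
  unfold point0
  split_ifs with h0
  · exact hx
  · exact ⟨hx, h, h0⟩


theorem exists_pred_of_mem_pending {v : V} :
    ∀ {x : WName V F₀.World F₁.World}, v ∈ pending e f g x → ∃ u, P.E u v
  | .vert u, h => by
    rw [pending] at h
    exact ⟨u, (e.mem_iff u v).1 h⟩
  | .pt0 _ _, h => by simp [pending] at h
  | .pt1 (.vert _) _, h => by simp [pending] at h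
  | .pt1 (.pt1 _ _) _, h => by simp [pending] at h
  | .pt1 (.pt0 x a) b, h => by
    rw [pending] at h
    split_ifs at h
    · exact exists_pred_of_mem_pending (List.mem_of_mem_tail h)
    · cases h

variable (e f g) in
/-- The world of a vertex, typed as a world of the model rather than of its frame. -/
def vertexWorld (v : V) : (encode e f g).World := vertWorld e f g v

/-- The name of a world of the model. -/
def worldName (x : (encode e f g).World) : WName V F₀.World F₁.World :=
  Subtype.val (p := IsWorld e f g) x

theorem isWorld_worldName (x : (encode e f g).World) : IsWorld e f g (worldName x) :=
  Subtype.property (p := IsWorld e f g) x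

theorem worldName_injective :
    Function.Injective (worldName : (encode e f g).World → WName V F₀.World F₁.World) :=
  Subtype.val_injective (p := IsWorld e f g)

theorem exists_worldName_eq {x : WName V F₀.World F₁.World} (hx : IsWorld e f g x) :
    ∃ y : (encode e f g).World, worldName y = x :=
  ⟨(⟨x, hx⟩ : {x // IsWorld e f g x}), rfl⟩

theorem worldName_eq_vert {x : (encode e f g).World} {v : V} :
    worldName x = .vert v ↔ x = vertexWorld e f g v :=
  ⟨fun h => worldName_injective h, fun h => by rw [h]; rfl⟩

theorem worldName_vertexWorld (v : V) : worldName (vertexWorld e f g v) = .vert v := rfl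

theorem point0_w0 (x : WName V F₀.World F₁.World) : point0 f x f.w0 = x := if_pos rfl

theorem point1_u0 (x : WName V F₀.World F₁.World) : point1 e f g x g.u0 = x := if_pos rfl

theorem rel0_def {x y : (encode e f g).World} :
    (encode e f g).Rel 0 x y ↔ ∃ (z : WName V F₀.World F₁.World) (a b : F₀.World),
      IsWorld e f g z ∧ IsEntry0 z ∧ worldName x = point0 f z a ∧ worldName y = point0 f z b ∧
        F₀.Rel () a b :=
  Iff.rfl

theorem rel1_def {x y : (encode e f g).World} :
    (encode e f g).Rel 1 x y ↔ ∃ (z : WName V F₀.World F₁.World) (a b : F₁.World),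
      IsWorld e f g z ∧ IsEntry1 P z ∧ worldName x = point1 e f g z a ∧
        worldName y = point1 e f g z b ∧ F₁.Rel () a b :=
  Iff.rfl

theorem rel0_iff {x y : (encode e f g).World} (hx : IsEntry0 (worldName x)) :
    (encode e f g).Rel 0 x y ↔ ∃ b, worldName y = point0 f (worldName x) b ∧ F₀.Rel () f.w0 b := by
  rw [rel0_def]
  constructor
  · rintro ⟨z, a, b, -, -, hxz, hyz, hr⟩
    unfold point0 at hxz
    split_ifs at hxz with ha
    · rw [ha] at hr
      exact ⟨b, hxz ▸ hyz, hr⟩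
    · rw [hxz] at hx
      exact hx.elim
  · rintro ⟨b, hy, hr⟩
    exact ⟨worldName x, f.w0, b, isWorld_worldName x, hx, (point0_w0 _).symm, hy, hr⟩

theorem rel1_iff {y z : (encode e f g).World} {x : WName V F₀.World F₁.World} {a : F₀.World}
    (hy : worldName y = .pt0 x a) :
    (encode e f g).Rel 1 y z ↔
      ∃ b, worldName z = point1 e f g (worldName y) b ∧ F₁.Rel () g.u0 b := by
  rw [rel1_def]
  constructor
  · rintro ⟨t, b, c, -, -, hyt, hzt, hr⟩
    unfold point1 at hyt
    split_ifs at hyt with h0 h1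
    · rw [h0] at hr
      exact ⟨c, hyt ▸ hzt, hr⟩
    · rw [hy] at hyt
      split at hyt <;> cases hyt
    · rw [hy] at hyt
      cases hyt
  · rintro ⟨b, hz, hr⟩
    exact ⟨worldName y, g.u0, b, isWorld_worldName y, by rw [hy]; trivial, (point1_u0 _).symm, hz,
      hr⟩

end Pending

/-- The ways of going on from a world where a choice is made: the choice of one of the branches,
followed by its confirmation. -/
def Choice (x z : (encode e f g).World) : Prop :=
  ∃ y, (encode e f g).Rel 0 x y ∧ IsBranch e f g (worldName y) ∧ (encode e f g).Rel 1 y z ∧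
    z ∈ (encode e f g).val .nxt1

variable {e f g}

/-- Going on from a world where a choice is made leads to the end `u1` of the copy of `F₁` at one of
the used branches: `nxt₀` excludes the other points of the copy of `F₀`, and `nxt₁` the other points
of the copies of `F₁`, even if the frames have more arrows than those used. -/
theorem choice_iff_point1 {x z : (encode e f g).World} (hx : pending e f g (worldName x) ≠ []) :
    Choice e f g x z ↔ z ∈ (encode e f g).val .nxt1 ∧
      (worldName z = point1 e f g (.pt0 (worldName x) f.w1) g.u1 ∨
        (2 ≤ (pending e f g (worldName x)).length ∧
          worldName z = point1 e f g (.pt0 (worldName x) f.w2) g.u1)) := by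
  have hx0 := isEntry0_of_pending hx
  have hlen : 1 ≤ (pending e f g (worldName x)).length := List.length_pos_of_ne_nil hx
  constructor
  · rintro ⟨y, hxy, hb, hyz, hz⟩
    refine ⟨hz, ?_⟩
    obtain ⟨a, hy, -⟩ := (rel0_iff hx0).1 hxy
    have hy' : worldName y = .pt0 (worldName x) a := by
      unfold point0 at hy
      split_ifs at hy
      · obtain ⟨t, ⟨ht, -⟩ | ⟨ht, -⟩⟩ := hb <;> rw [← hy, ht] at hx0 <;> exact hx0.elim
      · exact hy
    obtain ⟨b, hzb, -⟩ := (rel1_iff hy').1 hyz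
    have hb1 : b = g.u1 := by
      by_contra hne
      unfold point1 at hzb
      rw [if_neg hne, hy'] at hzb
      have hz' : (∃ u v, P.E u v ∧ worldName z = .vert v) ∨
        ((¬ ∃ v, worldName z = .vert v) ∧ pending e f g (worldName z) ≠ []) := hz
      split_ifs at hzb <;> rw [hzb] at hz' <;> simp [pending, hne] at hz'
    subst hb1
    rw [hy'] at hzb hb
    obtain ⟨t, ⟨ht, -⟩ | ⟨ht, h2⟩⟩ := hb
    · cases ht
      exact .inl hzb
    · cases ht
      exact .inr ⟨h2, hzb⟩
  · rintro ⟨hz, h | ⟨h2, h⟩⟩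
    · obtain ⟨y, hy⟩ := exists_worldName_eq
        (isWorld_pt0 (isWorld_worldName x) hx (a := f.w1) f.ne01.symm)
      exact ⟨y, (rel0_iff hx0).2 ⟨f.w1, by simp [hy, point0, f.ne01.symm], f.rel01⟩,
        ⟨worldName x, .inl ⟨hy, hlen⟩⟩, (rel1_iff hy).2 ⟨g.u1, hy ▸ h, g.rel01⟩, hz⟩
    · obtain ⟨y, hy⟩ := exists_worldName_eq
        (isWorld_pt0 (isWorld_worldName x) hx (a := f.w2) f.ne02.symm)
      exact ⟨y, (rel0_iff hx0).2 ⟨f.w2, by simp [hy, point0, f.ne02.symm], f.rel02⟩,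
        ⟨worldName x, .inr ⟨hy, h2⟩⟩, (rel1_iff hy).2 ⟨g.u1, hy ▸ h, g.rel01⟩, hz⟩

theorem vertexWorld_mem_nxt1 {v : V} (h : ∃ u, P.E u v) :
    vertexWorld e f g v ∈ (encode e f g).val .nxt1 :=
  h.elim fun u hu => .inl ⟨u, v, hu, rfl⟩

theorem vertexWorld_mem_nxt1_of_mem_pending {x : WName V F₀.World F₁.World} {v : V}
    (h : v ∈ pending e f g x) : vertexWorld e f g v ∈ (encode e f g).val .nxt1 :=
  vertexWorld_mem_nxt1 (exists_pred_of_mem_pending h)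

theorem choice_iff_of_singleton {x z : (encode e f g).World} {a : V}
    (hx : pending e f g (worldName x) = [a]) : Choice e f g x z ↔ z = vertexWorld e f g a := by
  have ha : vertexWorld e f g a ∈ (encode e f g).val .nxt1 :=
    vertexWorld_mem_nxt1_of_mem_pending (x := worldName x) (by simp [hx])
  rw [choice_iff_point1 (by simp [hx]), point1_u1, dest_w1, hx]
  simp only [List.head?_cons, List.length_singleton, Nat.reduceLeDiff, false_and, or_false,
    Option.elim_some, worldName_eq_vert]
  exact ⟨fun h => h.2, fun h => ⟨h ▸ ha, h⟩⟩

theorem choice_iff_of_pair {x z : (encode e f g).World} {a b : V}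
    (hx : pending e f g (worldName x) = [a, b]) :
    Choice e f g x z ↔ z = vertexWorld e f g a ∨ z = vertexWorld e f g b := by
  have ha : vertexWorld e f g a ∈ (encode e f g).val .nxt1 :=
    vertexWorld_mem_nxt1_of_mem_pending (x := worldName x) (by simp [hx])
  have hb : vertexWorld e f g b ∈ (encode e f g).val .nxt1 :=
    vertexWorld_mem_nxt1_of_mem_pending (x := worldName x) (by simp [hx])
  rw [choice_iff_point1 (by simp [hx]), point1_u1, point1_u1, dest_w1, dest_w2, hx]
  simp only [List.head?_cons, List.length_cons, List.length_nil, Nat.reduceAdd, if_true, le_refl,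
    true_and, List.getElem?_cons_succ, List.getElem?_cons_zero, Option.elim_some,
    worldName_eq_vert]
  exact ⟨fun h => h.2, fun h => ⟨by rcases h with rfl | rfl <;> assumption, h⟩⟩

/-- If at least three successors are left at `x`, then there is a world where all of them but the
first are left, and going on from `x` leads to this world or to the first of the successors. -/
theorem exists_choice_iff_of_length {x : (encode e f g).World} {a b c : V} {l : List V}
    (hx : pending e f g (worldName x) = a :: b :: c :: l) :
    ∃ y : (encode e f g).World, (¬ ∃ v, y = vertexWorld e f g v) ∧
      pending e f g (worldName y) = b :: c :: l ∧
      ∀ z, Choice e f g x z ↔ z = vertexWorld e f g a ∨ z = y := by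
  have hne : pending e f g (worldName x) ≠ [] := by simp [hx]
  have h3 : 3 ≤ (pending e f g (worldName x)).length := by simp [hx]
  have hd : dest e f g (.pt0 (worldName x) f.w2) = none := by rw [dest_w2, if_neg (by omega)]
  have hp : pending e f g (.pt1 (.pt0 (worldName x) f.w2) g.u1) = b :: c :: l := by
    rw [pending_pt1_w2 h3, hx]
    rfl
  have ha : vertexWorld e f g a ∈ (encode e f g).val .nxt1 :=
    vertexWorld_mem_nxt1_of_mem_pending (x := worldName x) (by simp [hx])
  have hw : IsWorld e f g (.pt1 (.pt0 (worldName x) f.w2) g.u1) :=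
    ⟨isWorld_pt0 (isWorld_worldName x) hne f.ne02.symm, trivial, g.ne01.symm, by simp [hd]⟩
  obtain ⟨y, hy⟩ := exists_worldName_eq hw
  have hyv : ¬ ∃ v, worldName y = .vert v := by simp [hy]
  have hyn : y ∈ (encode e f g).val .nxt1 :=
    .inr ⟨hyv, show pending e f g (worldName y) ≠ [] by simp [hy, hp]⟩
  refine ⟨y, by simpa only [worldName_eq_vert] using hyv, hy ▸ hp, fun z => ?_⟩
  rw [choice_iff_point1 hne, point1_u1, point1_u1, dest_w1, hd, hx]
  simp only [List.head?_cons, List.length_cons, Nat.le_add_left, true_and, Option.elim_some,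
    Option.elim_none, worldName_eq_vert, ← hy, worldName_injective.eq_iff]
  exact ⟨fun h => h.2, fun h => ⟨by rcases h with rfl | rfl <;> assumption, h⟩⟩

/-! ### The modalities of the winning region formula -/

theorem mem_continueOr {φ : GFormula} {ρ : Option ℕ → Set (encode e f g).World}
    {z : (encode e f g).World} :
    z ∈ (encode e f g).sem (GFormula.continueOr φ) ρ ↔
      (z ∈ ρ none ∧ ¬ ∃ v, z = vertexWorld e f g v) ∨
        (z ∈ (encode e f g).sem φ ρ ∧ ∃ v, z = vertexWorld e f g v) := by
  have : (∃ v, z = vertexWorld e f g v) ↔ z ∈ (encode e f g).val .pos :=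
    exists_congr fun v => worldName_eq_vert.symm
  rw [this]
  rfl

theorem mem_val_bd_of_branch {y : (encode e f g).World} (h : IsBranch e f g (worldName y)) :
    y ∈ (encode e f g).val .bd :=
  .inr (.inr h)

theorem mem_val_bd_of_nxt1 {z : (encode e f g).World} (h : z ∈ (encode e f g).val .nxt1) :
    z ∈ (encode e f g).val .bd :=
  h.elim (fun ⟨_, v, _, hv⟩ => .inl ⟨v, hv⟩) fun h => .inr (.inl h.2)

theorem mem_blackDia_iff {φ : GFormula} {ρ : Option ℕ → Set (encode e f g).World}
    {x : (encode e f g).World} :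
    x ∈ (encode e f g).sem (GFormula.blackDia φ) ρ ↔ pending e f g (worldName x) ≠ [] ∧
      ∃ z, Choice e f g x z ∧ z ∈ (encode e f g).sem (GFormula.continueOr φ)
        (Function.update ρ none ((encode e f g).sem (GFormula.blackDia φ) ρ)) := by
  conv_lhs => rw [GFormula.blackDia, KModel.sem]
  change x ∈ OrderHom.gfp _ ↔ _
  rw [← OrderHom.map_gfp]
  constructor
  · rintro ⟨hp, -, y, hxy, hb, -, -, z, hyz, hz, -, hc⟩
    exact ⟨hp, z, ⟨y, hxy, hb, hyz, hz⟩, hc⟩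
  · rintro ⟨hp, z, ⟨y, hxy, hb, hyz, hz⟩, hc⟩
    exact ⟨hp, .inr (.inl hp), y, hxy, hb, hb, mem_val_bd_of_branch hb, z, hyz, hz,
      mem_val_bd_of_nxt1 hz, hc⟩

theorem mem_blackBox_iff {φ : GFormula} {ρ : Option ℕ → Set (encode e f g).World}
    {x : (encode e f g).World} :
    x ∈ (encode e f g).sem (GFormula.blackBox φ) ρ ↔ (pending e f g (worldName x) ≠ [] →
      ∀ z, Choice e f g x z → z ∈ (encode e f g).sem (GFormula.continueOr φ)
        (Function.update ρ none ((encode e f g).sem (GFormula.blackBox φ) ρ))) := by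
  conv_lhs => rw [GFormula.blackBox, KModel.sem]
  change x ∈ OrderHom.gfp _ ↔ _
  rw [← OrderHom.map_gfp]
  constructor
  · rintro (h | h | h) hp z ⟨y, hxy, hb, hyz, hz⟩
    · exact absurd hp h
    · exact absurd (.inr (.inl hp)) h
    · rcases h y hxy with h | h | h | h
      · exact absurd hb h
      · exact absurd hb h
      · exact absurd (mem_val_bd_of_branch hb) h
      · rcases h z hyz with h | h | h
        · exact absurd hz h
        · exact absurd (mem_val_bd_of_nxt1 hz) h
        · exact h
  · intro h
    by_cases hp : pending e f g (worldName x) ≠ []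
    · refine .inr (.inr fun y hxy => ?_)
      by_cases hb : IsBranch e f g (worldName y)
      · refine .inr (.inr (.inr fun z hyz => ?_))
        by_cases hz : z ∈ (encode e f g).val .nxt1
        · exact .inr (.inr (h hp z ⟨y, hxy, hb, hyz, hz⟩))
        · exact .inl hz
      · exact .inl hb
    · exact .inl hp

theorem sem_var {j : ℕ} {ρ : Option ℕ → Set (encode e f g).World} :
    (encode e f g).sem (.var (some j)) ρ = ρ (some j) := rfl

theorem vertexWorld_mem_continueOr {j : ℕ} {ρ : Option ℕ → Set (encode e f g).World}
    {S : Set (encode e f g).World} {v : V} :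
    vertexWorld e f g v ∈ (encode e f g).sem (GFormula.continueOr (.var (some j)))
      (Function.update ρ none S) ↔ vertexWorld e f g v ∈ ρ (some j) := by
  rw [mem_continueOr, sem_var]
  simp

theorem mem_continueOr_of_not_vert {φ : GFormula} {ρ : Option ℕ → Set (encode e f g).World}
    {S : Set (encode e f g).World} {z : (encode e f g).World}
    (hz : ¬ ∃ v, z = vertexWorld e f g v) :
    z ∈ (encode e f g).sem (GFormula.continueOr φ) (Function.update ρ none S) ↔ z ∈ S := by
  rw [mem_continueOr]
  simp [hz]

/-- Since the lists of successors get shorter along a sequence of choices, the greatest fixed point in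
the definition of `⬧` admits no infinite sequence. -/
theorem mem_blackDia_var_iff {j : ℕ} {ρ : Option ℕ → Set (encode e f g).World}
    (x : (encode e f g).World) :
    x ∈ (encode e f g).sem (GFormula.blackDia (.var (some j))) ρ ↔
      ∃ v ∈ pending e f g (worldName x), vertexWorld e f g v ∈ ρ (some j) := by
  induction hl : pending e f g (worldName x) generalizing x with
  | nil => simp [mem_blackDia_iff, hl]
  | cons a l ih =>
    rw [mem_blackDia_iff]
    rcases l with _ | ⟨b, _ | ⟨c, l⟩⟩
    · simp [choice_iff_of_singleton hl, hl, vertexWorld_mem_continueOr]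
    · simp [choice_iff_of_pair hl, hl, or_and_right, exists_or, vertexWorld_mem_continueOr]
    · obtain ⟨y, hv, hp, hc⟩ := exists_choice_iff_of_length hl
      simp only [hc, or_and_right, exists_or, exists_eq_left, vertexWorld_mem_continueOr,
        mem_continueOr_of_not_vert hv, ih y hp]
      simp [hl]

theorem mem_blackBox_var_iff {j : ℕ} {ρ : Option ℕ → Set (encode e f g).World}
    (x : (encode e f g).World) :
    x ∈ (encode e f g).sem (GFormula.blackBox (.var (some j))) ρ ↔
      ∀ v ∈ pending e f g (worldName x), vertexWorld e f g v ∈ ρ (some j) := by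
  induction hl : pending e f g (worldName x) generalizing x with
  | nil => simp [mem_blackBox_iff, hl]
  | cons a l ih =>
    rw [mem_blackBox_iff]
    rcases l with _ | ⟨b, _ | ⟨c, l⟩⟩
    · simp [choice_iff_of_singleton hl, hl, vertexWorld_mem_continueOr]
    · simp [choice_iff_of_pair hl, hl, vertexWorld_mem_continueOr]
    · obtain ⟨y, hv, hp, hc⟩ := exists_choice_iff_of_length hl
      simp only [hc, forall_eq_or_imp, forall_eq, vertexWorld_mem_continueOr,
        mem_continueOr_of_not_vert hv, ih y hp]
      simp [hl]

theorem vertexWorld_mem_own {v : V} {p : Player} :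
    vertexWorld e f g v ∈ (encode e f g).val (.own p) ↔ P.owner v = p :=
  ⟨fun ⟨_, h, h'⟩ => by cases h; exact h', fun h => ⟨v, rfl, h⟩⟩

theorem vertexWorld_mem_par {v : V} {j : ℕ} :
    vertexWorld e f g v ∈ (encode e f g).val (.par j) ↔ P.parity v = j :=
  ⟨fun ⟨_, h, h'⟩ => by cases h; exact h', fun h => ⟨v, rfl, h⟩⟩

theorem vertexWorld_mem_disjunct {j : ℕ} {ρ : Option ℕ → Set (encode e f g).World} {v : V} :
    vertexWorld e f g v ∈ (encode e f g).sem (GFormula.disjunct j) ρ ↔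
      P.parity v = j ∧ v ∈ P.step fun j => vertexWorld e f g ⁻¹' ρ (some j) := by
  have hp : pending e f g (.vert v) = e.list v := by rw [pending]
  have hd := mem_blackDia_var_iff (j := j) (ρ := ρ) (vertexWorld e f g v)
  have hb := mem_blackBox_var_iff (j := j) (ρ := ρ) (vertexWorld e f g v)
  rw [worldName_vertexWorld, hp] at hd hb
  simp only [e.mem_iff] at hd hb
  change (vertexWorld e f g v ∈ (encode e f g).val (.par j) ∧
    vertexWorld e f g v ∈ (encode e f g).val (.own .eloise) ∧
    vertexWorld e f g v ∈ (encode e f g).sem (GFormula.blackDia (.var (some j))) ρ) ∨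
    (vertexWorld e f g v ∈ (encode e f g).val (.par j) ∧
    vertexWorld e f g v ∈ (encode e f g).val (.own .abelard) ∧
    vertexWorld e f g v ∈ (encode e f g).sem (GFormula.blackBox (.var (some j))) ρ) ↔ _
  rw [vertexWorld_mem_par, vertexWorld_mem_own, vertexWorld_mem_own, hd, hb, ← and_or_left]
  refine and_congr_right fun hj => ?_
  subst hj
  rfl

theorem preimage_sem_matrix {n : ℕ} (hn : ∀ v, P.parity v ≤ n)
    (ρ : Option ℕ → Set (encode e f g).World) :
    vertexWorld e f g ⁻¹' (encode e f g).sem (GFormula.matrix n) ρ =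
      P.step fun j => vertexWorld e f g ⁻¹' ρ (some j) := by
  have h (m : ℕ) (v : V) : vertexWorld e f g v ∈ (encode e f g).sem (GFormula.matrix m) ρ ↔
      P.parity v ≤ m ∧ v ∈ P.step fun j => vertexWorld e f g ⁻¹' ρ (some j) := by
    induction m with
    | zero => rw [Nat.le_zero]; exact vertexWorld_mem_disjunct
    | succ m ih =>
      change _ ∨ _ ↔ _
      rw [Nat.le_succ_iff, or_and_right]
      exact or_congr ih vertexWorld_mem_disjunct
  ext v
  exact (h n v).trans (and_iff_right (hn v))

theorem sat_winFormula_iff (e : P.SuccEnum) (f : Fork F₀) (g : Arrow F₁) {n : ℕ}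
    (hn : ∀ v, P.parity v ≤ n) :
    (encode e f g).Sat (vertexWorld e f g P.init) (winFormula n) ↔ P.EloiseWins := by
  rw [← init_mem_nestOp_iff hn fun _ => vertexWorld e f g ⁻¹' ∅]
  exact Set.ext_iff.1 (GFormula.preimage_sem_binds (encode e f g) (vertexWorld e f g)
    (preimage_sem_matrix hn) n fun _ => ∅) P.init

end ParityGame

/-! ### The frame of the model -/

/-- If a frame is glued from copies of `F` such that every world is in exactly one of them, then it
belongs to every class which contains `F` and is closed under isomorphic copies and disjoint
unions. -/
theorem mem_of_bijective_points {C : Set UFrame.{u}} (hI : ClosedUnderIso C)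
    (hU : ClosedUnderDisjointUnion C) {F : UFrame.{u}} (hF : F ∈ C) {I : Type u} [Nonempty I]
    {G : UFrame.{u}} (p : I → F.World → G.World)
    (hp : Function.Bijective fun q : Σ _ : I, F.World => p q.1 q.2)
    (hrel : ∀ x y, G.Rel () x y ↔ ∃ i a b, x = p i a ∧ y = p i b ∧ F.Rel () a b) : G ∈ C := by
  refine hI _ _ (hU I (fun _ => F) fun _ => hF) ⟨⟨Equiv.ofBijective _ hp, fun x y => ?_⟩⟩
  rw [hrel]
  constructor
  · rintro ⟨i, a, b, rfl, rfl, h⟩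
    exact ⟨i, a, b, rfl, rfl, h⟩
  · rintro ⟨i, a, b, hx, hy, h⟩
    exact ⟨i, a, b, hp.1 hx, hp.1 hy, h⟩

namespace ParityGame

variable {V : Type u} {P : ParityGame V} {e : P.SuccEnum}
  {F₀ F₁ : UFrame.{u}} {f : Fork F₀} {g : Arrow F₁}

variable (e f g) in
theorem encodeFrame_reduct_zero_mem {C : Set UFrame.{u}} (hI : ClosedUnderIso C)
    (hU : ClosedUnderDisjointUnion C) (hF : F₀ ∈ C) : (encodeFrame e f g).reduct 0 ∈ C := by
  let I := {z : WName V F₀.World F₁.World // IsWorld e f g z ∧ IsEntry0 z}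
  have : Nonempty I := ⟨⟨.vert P.init, trivial, trivial⟩⟩
  refine mem_of_bijective_points hI hU hF (I := I) (G := (encodeFrame e f g).reduct 0)
    (fun z a => (⟨point0 f z.1 a, isWorld_point0 z.2.1 z.2.2 a⟩ : {x // IsWorld e f g x}))
    ⟨?_, ?_⟩ fun x y => ?_
  · rintro ⟨⟨z, hz, hz0⟩, a⟩ ⟨⟨z', hz', hz0'⟩, a'⟩ h
    have h' : point0 f z a = point0 f z' a' := congrArg Subtype.val h
    unfold point0 at h'
    split_ifs at h' with h1 h2 h2
    · subst h1 h2 h'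
      rfl
    · subst h'
      exact hz0.elim
    · subst h'
      exact hz0'.elim
    · cases h'
      rfl
  · rintro ⟨x, hx⟩
    by_cases h0 : IsEntry0 x
    · exact ⟨⟨⟨x, hx, h0⟩, f.w0⟩, Subtype.ext (point0_w0 x)⟩
    · cases x with
      | vert v => exact absurd trivial h0
      | pt1 x b => exact absurd trivial h0
      | pt0 x a => exact ⟨⟨⟨x, hx.1, hx.2.1⟩, a⟩, Subtype.ext (if_neg hx.2.2)⟩
  · constructor
    · rintro ⟨z, a, b, hz, hz0, hx, hy, h⟩
      exact ⟨⟨z, hz, hz0⟩, a, b, Subtype.ext hx, Subtype.ext hy, h⟩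
    · rintro ⟨z, a, b, hx, hy, h⟩
      exact ⟨z.1, a, b, z.2.1, z.2.2, congrArg Subtype.val hx, congrArg Subtype.val hy, h⟩

variable (e f g) in
/-- The name of the world at which the choice from the successors of `u` but the first `i` is made,
if there is such a choice. -/
def remainder (u : V) : ℕ → WName V F₀.World F₁.World
  | 0 => .vert u
  | i + 1 => .pt1 (.pt0 (remainder u i) f.w2) g.u1

/-- The choices are made at the worlds `remainder f g u i` only. If `i ≠ 0`, then at least two
successors are left. -/
theorem exists_eq_remainder : ∀ {x : WName V F₀.World F₁.World}, pending e f g x ≠ [] →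
    ∃ u i, x = remainder f g u i ∧ pending e f g x = (e.list u).drop i ∧
      (i = 0 ∨ 2 ≤ (pending e f g x).length)
  | .vert u, _ => ⟨u, 0, rfl, by rw [pending]; rfl, .inl rfl⟩
  | .pt0 _ _, h => absurd (by simp [pending]) h
  | .pt1 (.vert _) _, h => absurd (by simp [pending]) h
  | .pt1 (.pt1 _ _) _, h => absurd (by simp [pending]) h
  | .pt1 (.pt0 x a) b, h => by
    by_cases hc : a = f.w2 ∧ b = g.u1 ∧ 3 ≤ (pending e f g x).length
    · obtain ⟨rfl, rfl, h3⟩ := hc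
      obtain ⟨u, i, rfl, hp, -⟩ := exists_eq_remainder (x := x)
        (List.ne_nil_of_length_pos (by omega))
      refine ⟨u, i + 1, rfl, ?_, .inr ?_⟩
      · rw [pending_pt1_w2 h3, hp, List.tail_drop]
      · rw [pending_pt1_w2 h3, List.length_tail]
        omega
    · exact absurd (by rw [pending, if_neg hc]) h

/-- The entry of a copy of `F₁` that leads to a vertex is determined by the move: it is the branch
`w1` for the first of the successors which are left, and the branch `w2` for the last one if two
are left. -/
theorem exists_of_dest_eq {y : WName V F₀.World F₁.World} {v : V}
    (h : dest e f g y = some v) : ∃ u j, (e.list u)[j]? = some v ∧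
      ((y = .pt0 (remainder f g u j) f.w1 ∧ (j = 0 ∨ j + 2 ≤ (e.list u).length)) ∨
        ∃ i, j = i + 1 ∧ (e.list u).length = j + 1 ∧ y = .pt0 (remainder f g u i) f.w2) := by
  cases y with
  | vert v => simp [dest] at h
  | pt1 x b => simp [dest] at h
  | pt0 x a =>
    have hne : pending e f g x ≠ [] := by
      intro hnil
      simp [dest, hnil] at h
    obtain ⟨u, i, rfl, hp, hi⟩ := exists_eq_remainder hne
    rw [dest, hp] at h
    rw [hp, List.length_drop] at hi
    split_ifs at h with h1 h2
    · subst h1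
      rw [List.head?_drop] at h
      exact ⟨u, i, h, .inl ⟨rfl, by omega⟩⟩
    · obtain ⟨rfl, h2⟩ := h2
      rw [List.getElem?_drop] at h
      rw [List.length_drop] at h2
      exact ⟨u, i + 1, h, .inr ⟨i, rfl, by omega, rfl⟩⟩

theorem dest_injective (hP : P.PredUnique) {y y' : WName V F₀.World F₁.World} {v : V}
    (h : dest e f g y = some v) (h' : dest e f g y' = some v) : y = y' := by
  obtain ⟨u, j, hj, hy⟩ := exists_of_dest_eq h
  obtain ⟨u', j', hj', hy'⟩ := exists_of_dest_eq h'
  obtain rfl : u = u' := hP v u u' ((e.mem_iff u v).1 (List.mem_of_getElem? hj))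
    ((e.mem_iff u' v).1 (List.mem_of_getElem? hj'))
  obtain rfl : j = j' := by
    obtain ⟨hlt, -⟩ := List.getElem?_eq_some_iff.1 hj
    exact (List.getElem?_inj hlt (e.nodup u)).1 (hj.trans hj'.symm)
  rcases hy with ⟨rfl, hj⟩ | ⟨i, hi, hl, rfl⟩ <;> rcases hy' with ⟨rfl, hj'⟩ | ⟨i', hi', hl', rfl⟩
  · rfl
  · omega
  · omega
  · obtain rfl : i = i' := by omega
    rfl

theorem exists_dest_eq_of_mem_pending {x : WName V F₀.World F₁.World} (hx : IsWorld e f g x)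
    {v : V} (hv : v ∈ pending e f g x) :
    ∃ y, IsWorld e f g y ∧ IsEntry1 P y ∧ dest e f g y = some v := by
  induction hl : pending e f g x generalizing x with
  | nil => simp [hl] at hv
  | cons a l ih =>
    have hne : pending e f g x ≠ [] := by simp [hl]
    rw [hl, List.mem_cons] at hv
    rcases hv with rfl | hv
    · exact ⟨.pt0 x f.w1, isWorld_pt0 hx hne f.ne01.symm, trivial, by rw [dest_w1, hl]; rfl⟩
    rcases l with _ | ⟨b, _ | ⟨c, l⟩⟩
    · cases hv
    · obtain rfl := List.mem_singleton.1 hv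
      exact ⟨.pt0 x f.w2, isWorld_pt0 hx hne f.ne02.symm, trivial, by rw [dest_w2, hl]; rfl⟩
    · have hp : pending e f g (.pt1 (.pt0 x f.w2) g.u1) = b :: c :: l := by
        rw [pending_pt1_w2 (by simp [hl]), hl]
        rfl
      refine ih (x := .pt1 (.pt0 x f.w2) g.u1)
        ⟨isWorld_pt0 hx hne f.ne02.symm, trivial, g.ne01.symm, ?_⟩ (hp ▸ hv) hp
      simp [dest_w2, hl]

theorem exists_pred_of_dest_eq {y : WName V F₀.World F₁.World} {v : V}
    (h : dest e f g y = some v) : ∃ u, P.E u v := by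
  obtain ⟨u, j, hj, -⟩ := exists_of_dest_eq h
  exact ⟨u, (e.mem_iff u v).1 (List.mem_of_getElem? hj)⟩

theorem point1_of_dest_eq {y : WName V F₀.World F₁.World} {v : V}
    (h : dest e f g y = some v) : point1 e f g y g.u1 = .vert v := by
  rw [point1_u1, h]
  rfl

/-- The points of a copy of `F₁` are its entry, the world of a vertex, or named after it. -/
theorem point1_cases (y : WName V F₀.World F₁.World) (b : F₁.World) :
    (b = g.u0 ∧ point1 e f g y b = y) ∨
      (b = g.u1 ∧ ∃ v, dest e f g y = some v ∧ point1 e f g y b = .vert v) ∨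
      point1 e f g y b = .pt1 y b := by
  by_cases h0 : b = g.u0
  · exact .inl ⟨h0, if_pos h0⟩
  by_cases h1 : b = g.u1
  · subst h1
    rw [point1_u1]
    rcases hd : dest e f g y with _ | v
    · exact .inr (.inr rfl)
    · exact .inr (.inl ⟨rfl, v, rfl, rfl⟩)
  · exact .inr (.inr (by rw [point1, if_neg h0, if_neg h1]))

theorem point1_injective (hP : P.PredUnique) {y y' : WName V F₀.World F₁.World}
    (hy : IsEntry1 P y) (hy' : IsEntry1 P y') {b b' : F₁.World}
    (h : point1 e f g y b = point1 e f g y' b') : y = y' ∧ b = b' := by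
  -- a vertex which is an entry has no predecessor, so that no copy of `F₁` leads to it
  have hv {z t : WName V F₀.World F₁.World} {v : V} (hz : IsEntry1 P z)
      (hd : dest e f g t = some v) : z ≠ .vert v := by
    rintro rfl
    obtain ⟨u, hu⟩ := exists_pred_of_dest_eq hd
    exact hz u hu
  have hp {z t : WName V F₀.World F₁.World} {c : F₁.World} (hz : IsEntry1 P z) :
      z ≠ .pt1 t c := by
    rintro rfl
    exact hz.elim
  rcases point1_cases (e := e) (f := f) (g := g) y b with
    ⟨rfl, h1⟩ | ⟨rfl, v, hd, h1⟩ | h1 <;>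
  rcases point1_cases (e := e) (f := f) (g := g) y' b' with
    ⟨rfl, h2⟩ | ⟨rfl, v', hd', h2⟩ | h2 <;> rw [h1, h2] at h
  · exact ⟨h, rfl⟩
  · exact absurd h (hv hy hd')
  · exact absurd h (hp hy)
  · exact absurd h.symm (hv hy' hd)
  · cases h
    exact ⟨dest_injective hP hd hd', rfl⟩
  · cases h
  · exact absurd h.symm (hp hy')
  · cases h
  · cases h
    exact ⟨rfl, rfl⟩

variable (e f g) in
theorem encodeFrame_reduct_one_mem (hP : P.PredUnique) {C : Set UFrame.{u}}
    (hI : ClosedUnderIso C) (hU : ClosedUnderDisjointUnion C) (hF : F₁ ∈ C) :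
    (encodeFrame e f g).reduct 1 ∈ C := by
  let I := {z : WName V F₀.World F₁.World // IsWorld e f g z ∧ IsEntry1 P z}
  have : Nonempty I := ⟨⟨.pt0 (.vert P.init) f.w1, ⟨trivial, trivial, f.ne01.symm⟩, trivial⟩⟩
  refine mem_of_bijective_points hI hU hF (I := I) (G := (encodeFrame e f g).reduct 1)
    (fun z b => (⟨point1 e f g z.1 b, isWorld_point1 z.2.1 z.2.2 b⟩ : {x // IsWorld e f g x}))
    ⟨?_, ?_⟩ fun x y => ?_
  · rintro ⟨⟨z, hz, hz1⟩, b⟩ ⟨⟨z', hz', hz1'⟩, b'⟩ h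
    obtain ⟨rfl, rfl⟩ := point1_injective hP hz1 hz1' (congrArg Subtype.val h)
    rfl
  · rintro ⟨x, hx⟩
    by_cases h1 : IsEntry1 P x
    · exact ⟨⟨⟨x, hx, h1⟩, g.u0⟩, Subtype.ext (point1_u0 x)⟩
    · cases x with
      | pt0 x a => exact absurd trivial h1
      | vert v =>
        obtain ⟨u, hu⟩ : ∃ u, P.E u v := by
          by_contra hne
          exact h1 (not_exists.1 hne)
        obtain ⟨y, hy, hy1, hd⟩ := exists_dest_eq_of_mem_pending (e := e) (f := f) (g := g)
          (x := .vert u) trivial (by rw [pending]; exact (e.mem_iff u v).2 hu)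
        exact ⟨⟨⟨y, hy, hy1⟩, g.u1⟩, Subtype.ext (point1_of_dest_eq hd)⟩
      | pt1 y b =>
        obtain ⟨hy, hy1, hb, hd⟩ := hx
        refine ⟨⟨⟨y, hy, hy1⟩, b⟩, Subtype.ext ?_⟩
        rcases point1_cases (e := e) (f := f) (g := g) y b with ⟨h, -⟩ | ⟨h, v, hv, -⟩ | h
        · exact absurd h hb
        · exact absurd ⟨h, by simp [hv]⟩ hd
        · exact h
  · constructor
    · rintro ⟨z, a, b, hz, hz1, hx, hy, h⟩
      exact ⟨⟨z, hz, hz1⟩, a, b, Subtype.ext hx, Subtype.ext hy, h⟩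
    · rintro ⟨z, a, b, hx, hy, h⟩
      exact ⟨z.1, a, b, z.2.1, z.2.2, congrArg Subtype.val hx, congrArg Subtype.val hy, h⟩

theorem encode_mem_fusion (e : P.SuccEnum) (f : Fork F₀) (g : Arrow F₁) (hP : P.PredUnique)
    {C₀ C₁ : Set UFrame.{u}} (hI₀ : ClosedUnderIso C₀) (hU₀ : ClosedUnderDisjointUnion C₀)
    (hI₁ : ClosedUnderIso C₁) (hU₁ : ClosedUnderDisjointUnion C₁) (hF₀ : F₀ ∈ C₀) (hF₁ : F₁ ∈ C₁) :
    (encode e f g).toKFrame ∈ fusion C₀ C₁ :=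
  ⟨encodeFrame_reduct_zero_mem e f g hI₀ hU₀ hF₀, encodeFrame_reduct_one_mem e f g hP hI₁ hU₁ hF₁⟩

end ParityGame

theorem mainTheorem3
    (C₀ C₁ : Set UFrame.{u})
    (hI₀ : ClosedUnderIso C₀) (hU₀ : ClosedUnderDisjointUnion C₀)
    (hI₁ : ClosedUnderIso C₁) (hU₁ : ClosedUnderDisjointUnion C₁)
    (F₀ F₁ : UFrame.{u}) (hF₀ : F₀ ∈ C₀) (hF₁ : F₁ ∈ C₁) (f : Fork F₀) (g : Arrow F₁)
    {V : Type u} (P : ParityGame V) (n : ℕ) (hn : ∀ v, P.parity v ≤ n) :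
    (∀ e : P.SuccEnum,
      ((ParityGame.encode e f g).Sat (ParityGame.vertWorld e f g P.init) (winFormula n) ↔
        P.EloiseWins) ∧
      (P.PredUnique → (ParityGame.encode e f g).toKFrame ∈ fusion C₀ C₁)) ∧
    (∀ e : P.unfold.SuccEnum,
      ((ParityGame.encode e f g).Sat (ParityGame.vertWorld e f g P.unfold.init) (winFormula n) ↔
        P.EloiseWins) ∧
      (ParityGame.encode e f g).toKFrame ∈ fusion C₀ C₁) := by
  refine ⟨fun e => ⟨ParityGame.sat_winFormula_iff e f g hn, fun hP =>
    ParityGame.encode_mem_fusion e f g hP hI₀ hU₀ hI₁ hU₁ hF₀ hF₁⟩, fun e => ⟨?_,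
    ParityGame.encode_mem_fusion e f g ParityGame.unfold_predUnique hI₀ hU₀ hI₁ hU₁ hF₀ hF₁⟩⟩
  exact (ParityGame.sat_winFormula_iff e f g fun v => hn v.1).trans
    (ParityGame.unfold_eloiseWins_iff hn)
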